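/- Let $d,N\ge 0$, $r\ge 1$ be integers and let $k_1,\dots,k_r\ge 1$ be (not necessarily distinct) integers. **Walks.** A walk $w$ of length $n$ in $\mathbb Z^d$ has a starting point $p_0$ and steps $\pm e_i$, with points $p_0,\dots,p_n$; it is closed if $p_n=p_0$. The multiplicity $mu(q,w)$ of $q\in\mathbb Z^d$ is the number of steps of $w$ leaving $q$ plus the number of steps arriving at $q$ (for $n\ge1$ this is $\delta_{q,p_0}+\delta_{q,p_n}+2\sum_{i=1}^{n-1}\delta_{q,p_i}$). For $k\ge 1$ put $N_{2k}(w)=\#\{q\in\mathbb Z^d : mu(q,w)=2k\}$. Let $W_{2N}$ be the finite set of closed walks from $0$ to $0$ of length $\le 2N$. For numbers $n_k\in\mathbb N$, $P(n_{k_1},\dots,n_{k_r})$ denotes the coefficient of $\lambda_{k_1}\cdots\lambda_{k_r}$ in $\prod_k(1+\lambda_k)^{n_k}$. **Green's function.** For $p\in\mathbb Z^d$ and complex $z$ with $2d|z|<1$ let $$h(p,d,z)=-\delta_{p,0}+\int_0^\infty e^{-y}\prod_{\alpha=1}^d I_{|p^{(\alpha)}|}(2zy)\,dy ,$$ $I_\mu$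 being the modified Bessel function. For a formal power series $g=\sum a_nz^n$ write $(g)_{z\diamond M}=\sum_{n\le M}a_nz^n$. **Index sets.** Let $D(k_1,\dots,k_r)$ be the set of classes of permutations $\sigma\in S_r$ under $\sigma\sim\hat\sigma\iff k_{\sigma(i)}=k_{\hat\sigma(i)}$ for all $i$. Let $J_r$ be the set of $Y=(Y_0,\dots,Y_{r-1})\in(\mathbb Z^d)^r$ with $Y_0=0$ and pairwise distinct entries; the entries are matched with the matrix and vertex indices $1,\dots,r$ in order. For $h=(h_1,\dots,h_r)\in\mathbb N^r$ let $H_r(h)$ be the set of $r\times r$ matrices $F$ over $\mathbb N$ with $F_{i,i}=0$ and $\sum_jF_{i,j}=\sum_jF_{j,i}=h_i$ for all $i$, and put $A=\mathrm{diag}(h_1,\dots,h_r)$. All cofactors of $A-F$ are then equal; their common value is $cof(A-F)$ (for $r=1$ it is $1$). **Vertex factors.** For $q\ge 0$, $k\ge1$ let $$K(q,k,\omega)=\begin{cases}\dfrac{(-1)^k}{q}\Bigl(\dfrac1{1+\omega}\Bigr)^k\displaystyle\sum_{\nu=\max(0,k-q)}^{k-1}\binom{k-1}{\nu}\binom{q}{k-\nu}(-\omega)^\nu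 & q>0,\\[2mm] \dfrac1k\Bigl(\dfrac{\omega}{1+\omega}\Bigr)^k & q=0.\end{cases}$$ **Theorem.** (a) For all $p\in\mathbb Z^d$ and $z\in\mathbb C$ with $2d|z|<1$ the integral defining $h(p,d,z)$ converges absolutely, and the Taylor series of $h(p,d,\cdot)$ at $0$ converges at $z$ to $h(p,d,z)$. For $\sigma\in D(k_1,\dots,k_r)$, $Y\in J_r$, $h\in\mathbb N^r$ and $F\in H_r(h)$ let $T_{\sigma,Y,h,F}$ be the power series (with the functions $h(\cdot,d,z)$ read as their Taylor series at $0$) $$cof(A-F)\Bigl(\prod_{1\le a,b\le r}\frac{h(Y_a-Y_b,d,z)^{F_{a,b}}}{(1+h(0,d,z))^{F_{a,b}}\,F_{a,b}!}\Bigr)\prod_{j=1}^r(-1)^{h_j}\,h_j!\,K\bigl(h_j,k_{\sigma(j)},h(0,d,z)\bigr).$$ (b) For each $\sigma$, $(T_{\sigma,Y,h,F})_{z\diamond 2N}\ne0$ for only finitely many triples $(Y,h,F)$ with $Y\in J_r$, $F\in H_r(h)$. (c) As polynomials in $z$, $$\sum_{w\in W_{2N}}P\bigl(N_{2k_1}(w),\dots,N_{2k_r}(w)\bigr)z^{length(w)}=\frac1{r!}\,z\frac{\partial}{\partial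 z}\sum_{\sigma\in D(k_1,\dots,k_r)}\ \sum_{Y\in J_r}\ \sum_{h\in\mathbb N^r}\ \sum_{F\in H_r(h)}(T_{\sigma,Y,h,F})_{z\diamond 2N}.$$ -/

import Mathlib

open Finset MeasureTheory
open scoped Nat PowerSeries

noncomputable section

namespace RangeMoments

/-! ### Walks on the hypercubic lattice -/

/-- The hypercubic lattice `ℤ ^ d`. -/
abbrev Lattice (d : ℕ) : Type := Fin d → ℤ

/-- A step is a coordinate direction together with a sign. -/
abbrev Step (d : ℕ) : Type := Fin d × ℤˣ

/-- The unit vector `± e_i` belonging to a step. -/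
def Step.vec {d : ℕ} (s : Step d) : Lattice d := Pi.single s.1 (s.2 : ℤ)

/-- A walk is a starting point together with a finite sequence of steps. -/
structure Walk (d : ℕ) where
  start : Lattice d
  steps : List (Step d)

/-- The length of a walk. -/
def Walk.length {d : ℕ} (w : Walk d) : ℕ := w.steps.length

/-- The `i`-th point of a walk (meaningful for `i ≤ w.length`). -/
def Walk.point {d : ℕ} (w : Walk d) (i : ℕ) : Lattice d :=
  w.start + ((w.steps.take i).map Step.vec).sum

/-- A walk is closed if its ending point is its starting point. -/
def Walk.IsClosed {d : ℕ} (w : Walk d) : Prop := w.point w.length = w.start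

/-- The multiplicity of `q` with respect to `w`: the number of steps of `w` that leave `q`
plus the number of steps of `w` that arrive at `q`. -/
def Walk.mu {d : ℕ} (q : Lattice d) (w : Walk d) : ℕ :=
  #{i ∈ range w.length | w.point i = q} + #{i ∈ range w.length | w.point (i + 1) = q}

/-- For a walk of positive length the multiplicity is
`δ_{q, p_0} + δ_{q, p_n} + 2 ∑_{0 < i < n} δ_{q, p_i}`. -/
theorem Walk.mu_eq {d : ℕ} (q : Lattice d) (w : Walk d) (hw : 0 < w.length) :
    w.mu q = (if q = w.point 0 then 1 else 0) + (if q = w.point w.length then 1 else 0)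
      + 2 * ∑ i ∈ Ico 1 w.length, if q = w.point i then 1 else 0 := by
  unfold Walk.mu
  rw [card_filter, card_filter]
  obtain ⟨n, hn⟩ : ∃ n, w.length = n + 1 := ⟨w.length - 1, by omega⟩
  rw [hn, sum_range_succ', sum_range_succ (fun i => if w.point (i + 1) = q then 1 else 0),
    Finset.sum_Ico_eq_sum_range]
  simp only [eq_comm (a := q), Nat.add_sub_cancel, add_comm 1]
  ring

/-- `N_{2k}(w)`: the number of lattice points of multiplicity `2k` with respect to `w`. -/
def Walk.multRange {d : ℕ} (k : ℕ) (w : Walk d) : ℕ :=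
  {q : Lattice d | w.mu q = 2 * k}.ncard

/-- Only finitely many points have a given positive multiplicity. -/
theorem Walk.finite_mu_eq {d : ℕ} (w : Walk d) {k : ℕ} (hk : 0 < k) :
    {q : Lattice d | w.mu q = 2 * k}.Finite := by
  refine ((range (w.length + 1)).image w.point).finite_toSet.subset ?_
  intro q hq
  by_contra hcon
  have h (i : ℕ) (hi : i ≤ w.length) : w.point i ≠ q := by
    rintro rfl
    exact hcon (by simpa using ⟨i, by omega, rfl⟩)
  have h1 : #{i ∈ range w.length | w.point i = q} = 0 := by
    rw [card_eq_zero, filter_eq_empty_iff]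
    exact fun i hi => h i (by simpa using (mem_range.1 hi).le)
  have h2 : #{i ∈ range w.length | w.point (i + 1) = q} = 0 := by
    rw [card_eq_zero, filter_eq_empty_iff]
    exact fun i hi => h (i + 1) (mem_range.1 hi)
  have : w.mu q = 2 * k := hq
  unfold Walk.mu at this
  omega

/-- The closed walks from `0` to `0` of length at most `M`. -/
def closedWalks (d M : ℕ) : Set (Walk d) :=
  {w | w.start = 0 ∧ w.IsClosed ∧ w.length ≤ M}

theorem closedWalks_finite (d M : ℕ) : (closedWalks d M).Finite := by
  have h := ((List.finite_length_le (Step d) M).image (fun l => (⟨0, l⟩ : Walk d)))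
  refine h.subset ?_
  rintro ⟨s, l⟩ ⟨h1, -, h3⟩
  exact ⟨l, h3, by simp only at h1; rw [h1]⟩

/-! ### The combinatorial symbol `P` -/

/-- `P(n_{k_1}, …, n_{k_r})`: the coefficient of `λ_{k_1} ⋯ λ_{k_r}` in
`∏ (1 + λ_m) ^ n_m`, where all variables other than `λ_{k_1}, …, λ_{k_r}` are set to `0`. -/
def symbolP (n : ℕ → ℕ) {r : ℕ} (k : Fin r → ℕ) : ℕ :=
  MvPolynomial.coeff (∑ j, Finsupp.single (k j) 1)
    (∏ m ∈ univ.image k, (1 + MvPolynomial.X m : MvPolynomial ℕ ℕ) ^ n m)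

/-! ### The lattice Green's function -/

/-- The modified Bessel function `I_m` of natural order. -/
def besselI (m : ℕ) (x : ℂ) : ℂ :=
  ∑' j : ℕ, (x / 2) ^ (2 * j + m) / ((j ! : ℂ) * ((j + m)! : ℂ))

/-- The integrand `e^{-y} ∏ I_{|p_α|}(2 z y)`. -/
def greenIntegrand {d : ℕ} (p : Lattice d) (z : ℂ) (y : ℝ) : ℂ :=
  Complex.exp (-(y : ℂ)) * ∏ α, besselI (p α).natAbs (2 * z * y)

/-- `h(p, d, z) = -δ_{p,0} + ∫_0^∞ e^{-y} ∏ I_{|p_α|}(2 z y) dy`. -/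
def green {d : ℕ} (p : Lattice d) (z : ℂ) : ℂ :=
  -(if p = 0 then 1 else 0) + ∫ y in Set.Ioi (0 : ℝ), greenIntegrand p z y

/-- The Taylor series of `z ↦ h(p, d, z)` at `0`. -/
def greenSeries {d : ℕ} (p : Lattice d) : ℂ⟦X⟧ :=
  PowerSeries.mk fun n => iteratedDeriv n (green p) 0 / (n ! : ℂ)

/-! ### Index sets -/

/-- Two permutations are equivalent if `k ∘ σ` and `k ∘ σ'` agree. -/
def permSetoid {r : ℕ} (k : Fin r → ℕ) : Setoid (Equiv.Perm (Fin r)) where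
  r σ σ' := ∀ i, k (σ i) = k (σ' i)
  iseqv := ⟨fun _ _ => rfl, fun h i => (h i).symm, fun h h' i => (h i).trans (h' i)⟩

/-- `D(k_1, …, k_r)`: the classes of permutations. -/
abbrev PermClass {r : ℕ} (k : Fin r → ℕ) : Type := Quotient (permSetoid k)

instance {r : ℕ} (k : Fin r → ℕ) : Fintype (PermClass k) := Fintype.ofFinite _

/-- The tuple `i ↦ k_{σ(i)}` of a class of permutations. -/
def PermClass.tuple {r : ℕ} {k : Fin r → ℕ} (σ : PermClass k) : Fin r → ℕ :=
  Quotient.lift (fun (τ : Equiv.Perm (Fin r)) i => k (τ i)) (fun _ _ h => funext h) σ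

/-- `J_r`: the `r`-tuples of distinct lattice points whose first entry is `0`. -/
def pointTuples (d r : ℕ) [NeZero r] : Set (Fin r → Lattice d) :=
  {Y | Y 0 = 0 ∧ ∀ i j, i ≠ j → Y i ≠ Y j}

/-- `H_r(h_1, …, h_r)`: the matrices of natural numbers with zero diagonal whose `i`-th row sum
and `i`-th column sum are both `h_i`. -/
def balanced {r : ℕ} (h : Fin r → ℕ) : Set (Matrix (Fin r) (Fin r) ℕ) :=
  {F | (∀ i, F i i = 0) ∧ ∀ i, ∑ j, F j i = h i ∧ ∑ j, F i j = h i}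

/-- The matrix `A - F` with `A = diag(h_1, …, h_r)`. -/
def laplacian {r : ℕ} (h : Fin r → ℕ) (F : Matrix (Fin r) (Fin r) ℕ) :
    Matrix (Fin r) (Fin r) ℤ :=
  Matrix.diagonal (fun i => (h i : ℤ)) - F.map (fun n => (n : ℤ))

/-- The cofactor of a square matrix: the entry of the adjugate in the first row and column. -/
def cof {r : ℕ} [NeZero r] (M : Matrix (Fin r) (Fin r) ℤ) : ℤ := M.adjugate 0 0

theorem adjugate_row_indep {r : ℕ} (M : Matrix (Fin r) (Fin r) ℤ)
    (hM : ∀ i, ∑ j, M i j = 0) (i i' j : Fin r) : M.adjugate i j = M.adjugate i' j := by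
  rw [Matrix.adjugate_apply, Matrix.adjugate_apply, ← sub_eq_zero]
  have key : (M.updateRow j (Pi.single i 1 - Pi.single i' 1)).det = 0 := by
    rw [← Matrix.exists_mulVec_eq_zero_iff]
    refine ⟨fun _ => 1, fun h => by simpa using congrFun h j, ?_⟩
    funext a
    by_cases ha : a = j
    · subst ha
      simp [Matrix.mulVec, dotProduct, Finset.sum_sub_distrib]
    · simp [Matrix.mulVec, dotProduct, Matrix.updateRow_ne ha, hM]
  have hadd := Matrix.det_updateRow_add M j (Pi.single i 1 - Pi.single i' 1) (Pi.single i' 1)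
  rw [sub_add_cancel, key, zero_add] at hadd
  rw [hadd, sub_self]

/-- For balanced `F` all cofactors of `A - F` agree. -/
theorem cof_indep {r : ℕ} [NeZero r] (h : Fin r → ℕ) {F : Matrix (Fin r) (Fin r) ℕ}
    (hF : F ∈ balanced h) (i j : Fin r) : (laplacian h F).adjugate i j = cof (laplacian h F) := by
  have h1 : ∀ i, ∑ j, laplacian h F i j = 0 := by
    intro i
    have := (hF.2 i).2
    simp [laplacian, Finset.sum_sub_distrib, Matrix.diagonal_apply, ← this]
  have h2 : ∀ i, ∑ j, (laplacian h F).transpose i j = 0 := by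
    intro i
    have := (hF.2 i).1
    simp [laplacian, Finset.sum_sub_distrib, Matrix.diagonal_apply, ← this]
  rw [adjugate_row_indep _ h1 i 0 j]
  have h3 := adjugate_row_indep _ h2 j 0 0
  rw [← Matrix.adjugate_transpose] at h3
  simpa [cof] using h3

/-! ### The summands -/

/-- The vertex factor `K(q, k, ω)`, for a formal power series `ω` (with `ω(0) ≠ -1`). -/
def vertexK (q k : ℕ) (ω : ℂ⟦X⟧) : ℂ⟦X⟧ :=
  if 0 < q then
    ((-1 : ℂ) ^ k * (1 / (q : ℂ))) • (((1 + ω)⁻¹) ^ k *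
      ∑ ν ∈ Icc (max 0 (k - q)) (k - 1),
        (((k - 1).choose ν : ℂ) * (q.choose (k - ν) : ℂ)) • (-ω) ^ ν)
  else (1 / (k : ℂ)) • (ω * (1 + ω)⁻¹) ^ k

/-- The summand belonging to a class `σ`, points `Y`, numbers `h` and a matrix `F`. -/
def summand {d r : ℕ} [NeZero r] {k : Fin r → ℕ} (σ : PermClass k) (Y : Fin r → Lattice d)
    (h : Fin r → ℕ) (F : Matrix (Fin r) (Fin r) ℕ) : ℂ⟦X⟧ :=
  (cof (laplacian h F) : ℂ) •
    ((∏ a, ∏ b, (1 / ((F a b)! : ℂ)) •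
        (greenSeries (Y a - Y b) ^ F a b * ((1 + greenSeries (0 : Lattice d))⁻¹) ^ F a b)) *
      ∏ j, ((-1 : ℂ) ^ h j * ((h j)! : ℂ)) •
        vertexK (h j) (σ.tuple j) (greenSeries (0 : Lattice d)))

/-- `(g)_{z ⋄ M}`: the part of the formal series `g` of degree at most `M`. -/
def diamond (M : ℕ) (g : ℂ⟦X⟧) : Polynomial ℂ := PowerSeries.trunc (M + 1) g

end RangeMoments

end

noncomputable section

namespace RangeMoments

/-! ### Numbers of walks -/

/-! The coefficients of the Green's function count walks: $\prod_\alpha I_{|p_\alpha|}(2z)$ is the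
exponential generating function of the walks from $0$ to $p$, the integral against $e^{-y}$ removes
the factorials, and $-\delta_{p,0}$ removes the empty walk (`coeff_besselProd`, `hasSum_green`).

Now fix distinct points $Y_a$ and let a walk pick up the weight $X_a = 1 + t_a$ whenever it leaves
$Y_a$. The coefficient of $\prod X_a^{\kappa_a}$ then counts the walks with exactly $\kappa_a$
visits to $Y_a$. Expanding in $t$ gives a renewal equation whose kernel is the matrix $B_{ab} = t_a
h(Y_b - Y_a)$. Summed over the starting points near $Y$, and without the free walks, the closed
walks have the generating function $z\,\partial_z \sum_m \mathrm{tr}(B^m)/m$, that is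
$-z\,\partial_z \log\det(1-B)$ (`sum_weightSum_sub`). The factor $n$ arises because a walk of length
$n$ can be cut at $n$ places.

Whittle's formula (`matrix_pow_apply`) sorts the words in $\mathrm{tr}(B^m)$ by their transition
numbers $F$. For closed words with row sums $h_i > 0$ and end $u$ the count is $h_u\,cof(A-F)\prod_i
(h_i-1)!/\prod F_{ij}!$; summing over $u$ produces $\sum_i h_i = m$, which cancels the $1/m$ of the
logarithm (`loopTerm_eq_whittle`). The diagonal entries of $F$ cancel in $A - F$, so they can be
summed separately at each vertex. Together with the coefficient $(-1)^{h+\kappa}\binom{h}{\kappa}$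
of $X^\kappa$ in $(X-1)^h$ this sum is the factor $K$, up to a power of $1/(1+h(0))$
(`vertex_identity`).

Finally $r!\,P$ counts ordered tuples of distinct points whose visit numbers form a rearrangement of
$k$, sorted by the class $\sigma$ (`factorial_mul_symbolP`). Translating the first point to $0$
turns such a tuple into an element of $J_r$ and a starting point (`sum_card_tuples`). The sums are
finite because a nonzero cofactor forces $F$ to be connected, and each edge of $F$ bounds the
distance of its end points (`finite_pointTuples`).

All series identities are proved modulo a power of $z$, so that every sum is finite and no formal
logarithm is needed. -/

/-- The number of walks of length `n` from `0` to `p`. -/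
def walkCount {d : ℕ} : ℕ → Lattice d → ℕ
  | 0, p => if p = 0 then 1 else 0
  | n + 1, p => ∑ s : Step d, walkCount n (p - s.vec)

theorem walkCount_le {d : ℕ} (n : ℕ) (p : Lattice d) : walkCount n p ≤ (2 * d) ^ n := by
  induction n generalizing p with
  | zero => simp only [walkCount]; split_ifs <;> simp
  | succ n ih =>
    simp only [walkCount]
    refine (sum_le_sum fun s _ => ih (p - s.vec)).trans ?_
    simp [Fintype.card_units_int, pow_succ]
    apply le_of_eq; ring

/-! ### Bessel functions as formal power series -/

/-- The power series of `x ↦ I_{|m|}(2x)`. -/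
def besselSeries (m : ℤ) : ℂ⟦X⟧ :=
  PowerSeries.mk fun n => ∑ x ∈ antidiagonal n,
    if (x.1 : ℤ) - x.2 = m then (1 / ((x.1)! * (x.2)! : ℂ)) else 0

/-- The pair `x` records the numbers of positive and negative steps on a line. The factor $n+1$ from
the derivative splits as `x.1 + x.2`, and each part lowers one of the two factorials, which amounts
to removing a step of that sign. -/
theorem derivative_besselSeries (m : ℤ) :
    PowerSeries.derivative ℂ (besselSeries m) = besselSeries (m - 1) + besselSeries (m + 1) := by
  ext n
  simp only [PowerSeries.coeff_derivative, besselSeries, PowerSeries.coeff_mk, map_add]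
  have h : (∑ x ∈ antidiagonal (n + 1),
      if (x.1 : ℤ) - x.2 = m then (1 / ((x.1)! * (x.2)! : ℂ)) else 0) * ((n : ℂ) + 1) =
      (∑ x ∈ antidiagonal (n + 1),
        if (x.1 : ℤ) - x.2 = m then ((x.1 : ℂ) / ((x.1)! * (x.2)! : ℂ)) else 0) +
      (∑ x ∈ antidiagonal (n + 1),
        if (x.1 : ℤ) - x.2 = m then ((x.2 : ℂ) / ((x.1)! * (x.2)! : ℂ)) else 0) := by
    rw [sum_mul, ← sum_add_distrib]
    refine sum_congr rfl fun x hx => ?_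
    have hx' : ((x.1 : ℂ) + x.2) = n + 1 := by
      exact_mod_cast congrArg (Nat.cast (R := ℂ)) (HasAntidiagonal.mem_antidiagonal.1 hx)
    split_ifs
    · rw [← hx']; ring
    · ring
  rw [h, Finset.Nat.sum_antidiagonal_succ, Finset.Nat.sum_antidiagonal_succ']
  simp only [Nat.cast_zero, zero_div, ite_self, zero_add]
  congr 1
  · refine sum_congr rfl fun x _ => ?_
    have : ((x.1 : ℂ) + 1) ≠ 0 := by exact_mod_cast Nat.succ_ne_zero x.1
    have h1 : ((x.1)! : ℂ) ≠ 0 := by exact_mod_cast Nat.factorial_ne_zero _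
    have h2 : ((x.2)! : ℂ) ≠ 0 := by exact_mod_cast Nat.factorial_ne_zero _
    refine if_congr (by push_cast; omega) ?_ rfl
    rw [Nat.factorial_succ]; push_cast; field_simp
  · refine sum_congr rfl fun x _ => ?_
    have : ((x.2 : ℂ) + 1) ≠ 0 := by exact_mod_cast Nat.succ_ne_zero x.2
    have h1 : ((x.1)! : ℂ) ≠ 0 := by exact_mod_cast Nat.factorial_ne_zero _
    have h2 : ((x.2)! : ℂ) ≠ 0 := by exact_mod_cast Nat.factorial_ne_zero _
    refine if_congr (by push_cast; omega) ?_ rfl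
    rw [Nat.factorial_succ]; push_cast; field_simp

theorem derivation_prod {ι R A : Type*} [DecidableEq ι] [CommRing R] [CommRing A] [Algebra R A]
    (D : Derivation R A A) (s : Finset ι) (f : ι → A) :
    D (∏ i ∈ s, f i) = ∑ i ∈ s, D (f i) * ∏ j ∈ s.erase i, f j := by
  induction s using Finset.induction_on with
  | empty => simp
  | insert a s ha ih =>
    rw [prod_insert ha, Derivation.leibniz, ih, sum_insert ha, erase_insert ha, smul_eq_mul,
      smul_eq_mul, mul_sum, add_comm, mul_comm (∏ i ∈ s, f i)]
    congr 1
    refine sum_congr rfl fun i hi => ?_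
    have hia : a ≠ i := fun h => ha (h ▸ hi)
    rw [erase_insert_of_ne hia, prod_insert (fun h => ha (mem_of_mem_erase h))]
    ring

/-- The exponential generating function of the numbers of walks to `p`. -/
def besselProd {d : ℕ} (p : Lattice d) : ℂ⟦X⟧ := ∏ α, besselSeries (p α)

/-- By the Leibniz rule each coordinate in turn is moved by $\pm 1$. This is the recursion of
`walkCount`, in exponential form. -/
theorem derivative_besselProd {d : ℕ} (p : Lattice d) :
    PowerSeries.derivative ℂ (besselProd p) = ∑ s : Step d, besselProd (p - s.vec) := by
  classical
  unfold besselProd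
  rw [derivation_prod, Fintype.sum_prod_type]
  refine sum_congr rfl fun α _ => ?_
  have key (u : ℤˣ) : ∏ β, besselSeries ((p - Step.vec (α, u)) β) =
      besselSeries (p α - u) * ∏ β ∈ univ.erase α, besselSeries (p β) := by
    rw [← mul_prod_erase univ _ (mem_univ α)]
    congr 1
    · simp [Step.vec]
    · refine prod_congr rfl fun β hβ => ?_
      simp [Step.vec, ne_of_mem_erase hβ]
  simp only [key, ← sum_mul, derivative_besselSeries]
  congr 1
  have : (univ : Finset ℤˣ) = {1, -1} := rfl
  rw [this, sum_pair (by decide)]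
  simp

theorem coeff_besselProd {d : ℕ} (n : ℕ) (p : Lattice d) :
    PowerSeries.coeff n (besselProd p) = (walkCount n p : ℂ) / (n ! : ℂ) := by
  induction n generalizing p with
  | zero =>
    simp only [besselProd, PowerSeries.coeff_zero_eq_constantCoeff, map_prod]
    have (m : ℤ) : PowerSeries.constantCoeff (besselSeries m) = if m = 0 then 1 else 0 := by
      simp [← PowerSeries.coeff_zero_eq_constantCoeff_apply, besselSeries, eq_comm]
    simp [this, walkCount, prod_ite_zero, funext_iff]
  | succ n ih =>
    have h := congrArg (PowerSeries.coeff n) (derivative_besselProd p)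
    rw [PowerSeries.coeff_derivative, map_sum] at h
    simp only [ih] at h
    have h0 : ((n : ℂ) + 1) ≠ 0 := by exact_mod_cast Nat.succ_ne_zero n
    have h1 : (n ! : ℂ) ≠ 0 := by exact_mod_cast Nat.factorial_ne_zero _
    rw [← eq_div_iff h0] at h
    rw [h, walkCount, Nat.factorial_succ, ← sum_div]
    push_cast
    field_simp

/-! ### Convergence of the power series -/

/-- The power series `f` converges absolutely at `x`, with sum `v`. -/
def SumsTo (f : ℂ⟦X⟧) (x v : ℂ) : Prop :=
  Summable (fun n => ‖PowerSeries.coeff n f * x ^ n‖) ∧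
    HasSum (fun n => PowerSeries.coeff n f * x ^ n) v

theorem SumsTo.mul {f g : ℂ⟦X⟧} {x v w : ℂ} (hf : SumsTo f x v) (hg : SumsTo g x w) :
    SumsTo (f * g) x (v * w) := by
  have h (n : ℕ) : PowerSeries.coeff n (f * g) * x ^ n = ∑ kl ∈ antidiagonal n,
      (PowerSeries.coeff kl.1 f * x ^ kl.1) * (PowerSeries.coeff kl.2 g * x ^ kl.2) := by
    rw [PowerSeries.coeff_mul, sum_mul]
    refine sum_congr rfl fun kl hkl => ?_
    rw [← HasAntidiagonal.mem_antidiagonal.1 hkl, pow_add]; ring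
  have h1 := summable_norm_sum_mul_antidiagonal_of_summable_norm hf.1 hg.1
  refine ⟨by simpa only [h] using h1, ?_⟩
  simp only [h]
  rw [← hf.2.tsum_eq, ← hg.2.tsum_eq,
    tsum_mul_tsum_eq_tsum_sum_antidiagonal_of_summable_norm hf.1 hg.1]
  exact h1.of_norm.hasSum

theorem SumsTo.one (x : ℂ) : SumsTo 1 x 1 := by
  have h : (fun n => PowerSeries.coeff n (1 : ℂ⟦X⟧) * x ^ n) = fun n => if n = 0 then 1 else 0 := by
    funext n
    by_cases hn : n = 0 <;> simp [PowerSeries.coeff_one, hn]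
  have h2 := hasSum_ite_eq (0 : ℕ) (1 : ℂ)
  refine ⟨?_, by rw [h]; exact h2⟩
  have : (fun n => ‖PowerSeries.coeff n (1 : ℂ⟦X⟧) * x ^ n‖) = fun n => if n = 0 then 1 else 0 := by
    funext n
    by_cases hn : n = 0 <;> simp [PowerSeries.coeff_one, hn]
  rw [this]; exact (hasSum_ite_eq (0 : ℕ) (1 : ℝ)).summable

theorem SumsTo.prod {ι : Type*} (s : Finset ι) {f : ι → ℂ⟦X⟧} {x : ℂ} {v : ι → ℂ}
    (h : ∀ i ∈ s, SumsTo (f i) x (v i)) : SumsTo (∏ i ∈ s, f i) x (∏ i ∈ s, v i) := by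
  classical
  induction s using Finset.induction_on with
  | empty => simpa using SumsTo.one x
  | insert a s ha ih =>
    rw [prod_insert ha, prod_insert ha]
    exact (h a (mem_insert_self a s)).mul (ih fun i hi => h i (mem_insert_of_mem hi))

theorem sumsTo_besselSeries (m : ℤ) (x : ℂ) :
    SumsTo (besselSeries m) x (besselI m.natAbs (2 * x)) := by
  have hn : Summable (fun n => ‖PowerSeries.coeff n (besselSeries m) * x ^ n‖) := by
    -- Without the condition on the difference of the two indices, the coefficients are those of the
    -- square of the exponential series; that square dominates.
    have h0 : Summable (fun n : ℕ => ‖x ^ n / (n ! : ℂ)‖) :=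
      NormedSpace.norm_expSeries_div_summable (𝔸 := ℂ) x
    have h1 : Summable (fun n : ℕ => ‖‖x ^ n / (n ! : ℂ)‖‖) := by simpa using h0
    have h2 := (summable_norm_sum_mul_antidiagonal_of_summable_norm h1 h1).of_norm
    refine h2.of_nonneg_of_le (fun _ => norm_nonneg _) fun n => ?_
    simp only [besselSeries, PowerSeries.coeff_mk, sum_mul]
    refine (norm_sum_le _ _).trans (sum_le_sum fun y hy => ?_)
    rw [← norm_mul]
    split_ifs
    · rw [← HasAntidiagonal.mem_antidiagonal.1 hy, pow_add]
      apply le_of_eq; congr 1; ring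
    · rw [zero_mul, norm_zero]; positivity
  refine ⟨hn, ?_⟩
  have hinj : Function.Injective (fun j : ℕ => 2 * j + m.natAbs) := fun a b h => by
    simp only at h; omega
  have hval (j : ℕ) : PowerSeries.coeff (2 * j + m.natAbs) (besselSeries m) =
      1 / ((j ! : ℂ) * ((j + m.natAbs)! : ℂ)) := by
    simp only [besselSeries, PowerSeries.coeff_mk]
    rcases le_total 0 m with hm | hm
    · rw [sum_eq_single (j + m.natAbs, j)]
      · rw [if_pos (by simp only; omega), mul_comm]
      · rintro ⟨a, b⟩ hab hne
        rw [HasAntidiagonal.mem_antidiagonal] at hab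
        refine if_neg fun h => hne ?_
        simp only at h hab
        rw [Prod.mk.injEq]; omega
      · intro h; exact absurd (HasAntidiagonal.mem_antidiagonal.2 (by simp only; omega)) h
    · rw [sum_eq_single (j, j + m.natAbs)]
      · rw [if_pos (by simp only; omega)]
      · rintro ⟨a, b⟩ hab hne
        rw [HasAntidiagonal.mem_antidiagonal] at hab
        refine if_neg fun h => hne ?_
        simp only at h hab
        rw [Prod.mk.injEq]; omega
      · intro h; exact absurd (HasAntidiagonal.mem_antidiagonal.2 (by simp only; omega)) h
  -- Two natural numbers with difference `m` have the sum `2 * j + |m|`, where `j` is the smaller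
  -- one; other exponents do not occur.
  have hzero : ∀ n ∉ Set.range (fun j : ℕ => 2 * j + m.natAbs),
      PowerSeries.coeff n (besselSeries m) * x ^ n = 0 := by
    intro n hn
    simp only [besselSeries, PowerSeries.coeff_mk]
    rw [sum_eq_zero, zero_mul]
    rintro ⟨a, b⟩ hab
    rw [HasAntidiagonal.mem_antidiagonal] at hab
    refine if_neg fun h => hn ⟨min a b, ?_⟩
    simp only at h hab ⊢
    omega
  have hs := hn.of_norm.hasSum
  have := (hinj.hasSum_iff hzero).2 hs
  have h3 : besselI m.natAbs (2 * x) = ∑' n, PowerSeries.coeff n (besselSeries m) * x ^ n := by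
    rw [← this.tsum_eq, besselI]
    refine tsum_congr fun j => ?_
    simp only [Function.comp, hval]
    rw [mul_div_cancel_left₀ _ (two_ne_zero)]
    ring
  rw [h3]; exact hs

theorem hasSum_prod_besselI {d : ℕ} (p : Lattice d) (x : ℂ) :
    HasSum (fun n => (walkCount n p : ℂ) / (n ! : ℂ) * x ^ n)
      (∏ α, besselI (p α).natAbs (2 * x)) := by
  have := (SumsTo.prod univ fun α _ => sumsTo_besselSeries (p α) x).2
  rw [show ∏ i, besselSeries (p i) = besselProd p from rfl] at this
  simpa only [coeff_besselProd] using this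

/-! ### The lattice Green's function -/

theorem integrableOn_exp_neg_mul_pow (n : ℕ) :
    IntegrableOn (fun y : ℝ => Real.exp (-y) * y ^ n) (Set.Ioi 0) := by
  have := Real.GammaIntegral_convergent (s := n + 1) (by positivity)
  simpa using this

theorem integral_exp_neg_mul_pow (n : ℕ) :
    ∫ y in Set.Ioi (0 : ℝ), Real.exp (-y) * y ^ n = n ! := by
  rw [← Real.Gamma_nat_eq_factorial, Real.Gamma_eq_integral (by positivity)]
  simp

/-- The terms of the expansion of the Green's function integrand. -/
def greenTerm {d : ℕ} (p : Lattice d) (z : ℂ) (n : ℕ) (y : ℝ) : ℂ :=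
  ((walkCount n p : ℂ) / (n ! : ℂ) * z ^ n) * ((Real.exp (-y) * y ^ n : ℝ) : ℂ)

theorem hasSum_greenTerm {d : ℕ} (p : Lattice d) (z : ℂ) (y : ℝ) :
    HasSum (fun n => greenTerm p z n y) (greenIntegrand p z y) := by
  have := (hasSum_prod_besselI p (z * y)).mul_left (Complex.exp (-(y : ℂ)))
  rw [greenIntegrand]
  convert! this using 1
  · funext n
    simp only [greenTerm]
    push_cast
    ring
  · simp only [mul_assoc]

theorem integrable_greenTerm {d : ℕ} (p : Lattice d) (z : ℂ) (n : ℕ) :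
    IntegrableOn (greenTerm p z n) (Set.Ioi 0) :=
  ((integrableOn_exp_neg_mul_pow n).ofReal).const_mul _

/-- The Gamma integral $n!$ turns the exponential generating function into an ordinary one. -/
theorem integral_greenTerm {d : ℕ} (p : Lattice d) (z : ℂ) (n : ℕ) :
    ∫ y in Set.Ioi (0 : ℝ), greenTerm p z n y = walkCount n p * z ^ n := by
  simp only [greenTerm]
  rw [integral_const_mul, integral_complex_ofReal, integral_exp_neg_mul_pow]
  have h1 : (n ! : ℂ) ≠ 0 := by exact_mod_cast Nat.factorial_ne_zero _
  push_cast
  field_simp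

theorem integral_norm_greenTerm {d : ℕ} (p : Lattice d) (z : ℂ) (n : ℕ) :
    ∫ y in Set.Ioi (0 : ℝ), ‖greenTerm p z n y‖ = walkCount n p * ‖z‖ ^ n := by
  have : ∀ y ∈ Set.Ioi (0 : ℝ), ‖greenTerm p z n y‖ =
      ((walkCount n p : ℝ) / (n ! : ℝ) * ‖z‖ ^ n) * (Real.exp (-y) * y ^ n) := by
    intro y hy
    have hy' : 0 ≤ y := le_of_lt hy
    rw [greenTerm, norm_mul, Complex.norm_real, Real.norm_of_nonneg (by positivity)]
    simp
  rw [setIntegral_congr_fun measurableSet_Ioi this, integral_const_mul, integral_exp_neg_mul_pow]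
  have h1 : (n ! : ℝ) ≠ 0 := by exact_mod_cast Nat.factorial_ne_zero _
  field_simp

theorem summable_walkCount {d : ℕ} (p : Lattice d) {x : ℝ} (h0 : 0 ≤ x) (hx : 2 * (d : ℝ) * x < 1) :
    Summable (fun n => (walkCount n p : ℝ) * x ^ n) := by
  refine (summable_geometric_of_lt_one (by positivity) hx).of_nonneg_of_le
    (fun n => by positivity) fun n => ?_
  rw [mul_pow]
  gcongr
  exact_mod_cast walkCount_le n p

/-- Since there are at most $(2d)^n$ walks of length $n$, the integrand is dominated by
$e^{-(1-2d|z|)y}$. -/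
theorem integrableOn_greenIntegrand {d : ℕ} (p : Lattice d) {z : ℂ}
    (hz : 2 * (d : ℝ) * ‖z‖ < 1) : IntegrableOn (greenIntegrand p z) (Set.Ioi 0) := by
  have h : greenIntegrand p z = fun y => ∑' n, greenTerm p z n y :=
    funext fun y => (hasSum_greenTerm p z y).tsum_eq.symm
  have hm (n : ℕ) : Measurable (greenTerm p z n) := by unfold greenTerm; fun_prop
  have hmeas : Measurable (greenIntegrand p z) := by
    refine measurable_of_tendsto_metrizable (f := fun n y => ∑ i ∈ range n, greenTerm p z i y)
      (fun n => Finset.measurable_sum _ fun i _ => hm i) ?_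
    rw [tendsto_pi_nhds]
    exact fun y => (hasSum_greenTerm p z y).tendsto_sum_nat
  have hint : IntegrableOn (fun y : ℝ => Real.exp (-(1 - 2 * d * ‖z‖) * y)) (Set.Ioi 0) :=
    exp_neg_integrableOn_Ioi 0 (by linarith)
  refine Integrable.mono' hint hmeas.aestronglyMeasurable ?_
  refine (ae_restrict_iff' measurableSet_Ioi).2 (Filter.Eventually.of_forall fun y hy => ?_)
  have hy' : 0 ≤ y := le_of_lt hy
  have hs : HasSum (fun n : ℕ => Real.exp (-y) * ((2 * d * ‖z‖ * y) ^ n / n !))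
      (Real.exp (-y) * Real.exp (2 * d * ‖z‖ * y)) := by
    rw [Real.exp_eq_exp_ℝ]
    exact (NormedSpace.expSeries_div_hasSum_exp (𝔸 := ℝ) _).mul_left _
  rw [← Real.exp_add] at hs
  rw [show -(1 - 2 * d * ‖z‖) * y = -y + 2 * d * ‖z‖ * y by ring]
  refine (hasSum_greenTerm p z y).norm_le_of_bounded hs fun n => ?_
  rw [greenTerm, norm_mul, Complex.norm_real, Real.norm_of_nonneg (by positivity)]
  simp only [norm_mul, norm_div, norm_pow, Complex.norm_natCast]
  have : (walkCount n p : ℝ) ≤ (2 * d) ^ n := by exact_mod_cast walkCount_le n p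
  calc (walkCount n p : ℝ) / n ! * ‖z‖ ^ n * (Real.exp (-y) * y ^ n)
      ≤ (2 * d) ^ n / n ! * ‖z‖ ^ n * (Real.exp (-y) * y ^ n) := by gcongr
    _ = _ := by rw [mul_pow, mul_pow]; ring

/-- The number of walks of length `n` from `0` to `p`, with the empty walk left out. -/
def stepCount {d : ℕ} (n : ℕ) (p : Lattice d) : ℕ := if n = 0 then 0 else walkCount n p

/-- Sum and integral are interchanged because the $L^1$ norms of the terms are summable; the term
$-\delta_{p,0}$ cancels the term $n = 0$. -/
theorem hasSum_green {d : ℕ} (p : Lattice d) {z : ℂ} (hz : 2 * (d : ℝ) * ‖z‖ < 1) :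
    HasSum (fun n => (stepCount n p : ℂ) * z ^ n) (green p z) := by
  have h1 := hasSum_integral_of_summable_integral_norm
    (μ := volume.restrict (Set.Ioi (0 : ℝ))) (F := greenTerm p z)
    (fun n => integrable_greenTerm p z n)
    (by simpa only [integral_norm_greenTerm] using summable_walkCount p (norm_nonneg z) hz)
  simp only [integral_greenTerm, fun y => (hasSum_greenTerm p z y).tsum_eq] at h1
  have h2 := (hasSum_ite_eq (0 : ℕ) (-(if p = 0 then 1 else 0) : ℂ)).add h1
  rw [green]
  convert! h2 using 1
  funext n
  rcases n with _ | n
  · by_cases hp : p = 0 <;> simp [stepCount, walkCount, hp]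
  · simp [stepCount]

theorem coeff_greenSeries {d : ℕ} (n : ℕ) (p : Lattice d) :
    PowerSeries.coeff n (greenSeries p) = (stepCount n p : ℂ) := by
  have h : HasFPowerSeriesAt (green p)
      (FormalMultilinearSeries.ofScalars ℂ fun n => (stepCount n p : ℂ)) 0 := by
    rw [hasFPowerSeriesAt_iff]
    have : ∀ᶠ z : ℂ in nhds 0, 2 * (d : ℝ) * ‖z‖ < 1 := by
      have hc : Continuous fun z : ℂ => 2 * (d : ℝ) * ‖z‖ := by fun_prop
      exact hc.continuousAt.eventually_lt continuousAt_const (by simp)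
    filter_upwards [this] with z hz
    simpa [mul_comm] using hasSum_green p hz
  have h2 := h.analyticAt.hasFPowerSeriesAt
  have h3 := congrArg (fun q : FormalMultilinearSeries ℂ ℂ ℂ => q.coeff n)
    (h.eq_formalMultilinearSeries h2)
  simp only [FormalMultilinearSeries.coeff_ofScalars] at h3
  rw [h3, greenSeries, PowerSeries.coeff_mk]

theorem green_expansion {d : ℕ} (p : Lattice d) {z : ℂ} (hz : 2 * (d : ℝ) * ‖z‖ < 1) :
    HasSum (fun n : ℕ => PowerSeries.coeff n (greenSeries p) * z ^ n) (green p z) := by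
  simpa only [coeff_greenSeries] using hasSum_green p hz

/-! ### Counting words with given transition numbers -/

section Whittle

theorem sub_single_add_single {V : Type*} [DecidableEq V] {F : Matrix V V ℕ} {u w : V} (h : 0 < F u w) :
    F - Matrix.single u w 1 + Matrix.single u w 1 = F := by
  ext i j
  simp only [Matrix.add_apply, Matrix.sub_apply, Matrix.single_apply]
  split_ifs with hij
  · obtain ⟨rfl, rfl⟩ := hij; omega
  · simp

variable {V : Type*} [Fintype V] [DecidableEq V]

/-- The sum of the `i`-th row. -/
def rowSum (F : Matrix V V ℕ) (i : V) : ℕ := ∑ j, F i j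

/-- The matrix whose determinant counts the trees directed towards `v`: the Laplacian of `F`, with
the row of `v` and the zero rows replaced by unit vectors. -/
def rootedLaplacian (v : V) (F : Matrix V V ℕ) : Matrix V V ℤ := Matrix.of fun i =>
  if i = v ∨ rowSum F i = 0 then Pi.single i 1
  else (rowSum F i : ℤ) • Pi.single i 1 - fun j => (F i j : ℤ)

/-- Whittle's expression for the number of words that end in `v` and whose transition numbers are
given by `F`, times `∏ (F i j)!`. -/
def whittle (v : V) (F : Matrix V V ℕ) : ℤ :=
  (rootedLaplacian v F).det * (rowSum F v)! * ∏ i ∈ univ.erase v, ((rowSum F i - 1)! : ℤ)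

/-- `F` satisfies the flow conditions of the transition numbers of a word from `u` to `v`. -/
def IsFlow (u v : V) (F : Matrix V V ℕ) : Prop :=
  ∀ i, rowSum F i + (if i = v then 1 else 0) = rowSum F.transpose i + (if i = u then 1 else 0)

theorem rowSum_sub_single_ne (F : Matrix V V ℕ) {u w i : V} (h : i ≠ u) :
    rowSum (F - Matrix.single u w 1) i = rowSum F i := by
  refine sum_congr rfl fun j _ => ?_
  simp [h.symm]

theorem rowSum_add_single (F : Matrix V V ℕ) (u w i : V) :
    rowSum (F + Matrix.single u w 1) i = rowSum F i + if i = u then 1 else 0 := by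
  unfold rowSum
  simp only [Matrix.add_apply, sum_add_distrib, Matrix.single_apply]
  by_cases h : i = u
  · simp [h]
  · simp [h, Ne.symm h]

theorem rowSum_sub_single_self {F : Matrix V V ℕ} {u w : V} (h : 0 < F u w) :
    rowSum (F - Matrix.single u w 1) u = rowSum F u - 1 := by
  have := rowSum_add_single (F - Matrix.single u w 1) u w u
  rw [sub_single_add_single h, if_pos rfl] at this
  omega

/-- The indicator of the indices with nonzero row sum lies in the kernel: by `hc` no transition
leads out of this set, so its Laplacian rows annihilate the indicator, and the unit rows all sit
outside it because `hv` puts `v` there. -/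
theorem rootedLaplacian_det_eq_zero {v : V} {F : Matrix V V ℕ} (hF : F ≠ 0)
    (hv : rowSum F v = 0) (hc : ∀ i, rowSum F i = 0 → rowSum F.transpose i = 0) :
    (rootedLaplacian v F).det = 0 := by
  rw [← Matrix.exists_mulVec_eq_zero_iff]
  refine ⟨fun i => if rowSum F i = 0 then 0 else 1, fun h => hF ?_, ?_⟩
  · ext i j
    have h1 := congrFun h i
    simp only [Pi.zero_apply, ite_eq_left_iff, one_ne_zero, imp_false, not_not] at h1
    exact (sum_eq_zero_iff.1 h1) j (mem_univ j)
  · funext i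
    rw [Matrix.mulVec, rootedLaplacian]
    by_cases hi : rowSum F i = 0
    · simp [Matrix.of_apply, hi]
    · have hiv : i ≠ v := fun h => hi (h ▸ hv)
      have hcol (j : V) (hj : rowSum F j = 0) : F i j = 0 :=
        (sum_eq_zero_iff.1 (hc j hj)) i (mem_univ i)
      have : ∑ j, (F i j : ℤ) * (if rowSum F j = 0 then 0 else 1) = rowSum F i := by
        rw [rowSum, Nat.cast_sum]
        refine sum_congr rfl fun j _ => ?_
        split_ifs with hj
        · simp [hcol j hj]
        · simp
      simp only [Matrix.of_apply, hi, hiv, or_self, if_false]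
      rw [sub_dotProduct, smul_dotProduct, single_dotProduct]
      simp only [dotProduct, this]
      simp [hi]

/-- Removing a transition out of `v` changes only the row of `v`, which the determinant does not
see. Hence only the factor `(rowSum F v)!` drops, and the sum over `w` restores it. If nothing
leaves `v`, both sides vanish. -/
theorem whittle_recurrence_self {v : V} {F : Matrix V V ℕ} (hF : F ≠ 0) (hf : IsFlow v v F) :
    whittle v F = ∑ w, (F v w : ℤ) * whittle v (F - Matrix.single v w 1) := by
  by_cases hv : rowSum F v = 0
  · have hc : ∀ i, rowSum F i = 0 → rowSum F.transpose i = 0 := fun i hi => by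
      have := hf i; omega
    rw [whittle, rootedLaplacian_det_eq_zero hF hv hc, zero_mul, zero_mul]
    symm
    refine sum_eq_zero fun w _ => ?_
    rw [(sum_eq_zero_iff.1 hv) w (mem_univ w)]; simp
  · have key (w : V) : (F v w : ℤ) * whittle v (F - Matrix.single v w 1) =
        F v w * ((rootedLaplacian v F).det * (rowSum F v - 1)! *
          ∏ i ∈ univ.erase v, ((rowSum F i - 1)! : ℤ)) := by
      rcases Nat.eq_zero_or_pos (F v w) with h | h
      · simp [h]
      · congr 1
        have hM : rootedLaplacian v (F - Matrix.single v w 1) = rootedLaplacian v F := by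
          ext i j
          simp only [rootedLaplacian, Matrix.of_apply]
          by_cases hi : i = v
          · simp [hi]
          · rw [rowSum_sub_single_ne F hi]
            simp [hi, Ne.symm hi]
        rw [whittle, hM, rowSum_sub_single_self h]
        congr 1
        exact prod_congr rfl fun i hi => by rw [rowSum_sub_single_ne F (ne_of_mem_erase hi)]
    simp only [key]
    rw [← sum_mul, ← Nat.cast_sum, ← rowSum, whittle]
    obtain ⟨m, hm⟩ := Nat.exists_eq_succ_of_ne_zero hv
    rw [hm, Nat.succ_sub_one, Nat.factorial_succ]
    push_cast
    ring

/-- The determinant is linear in the row of `u`, and removing `u → w` subtracts $e_u - e_w$ from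
that row. Weighted by `F u w`, these differences add up to the row itself, so the sum over `w` of
the new determinants is `rowSum F u - 1` times the old one. This is the ratio of the factorials. -/
theorem whittle_recurrence_ne {u v : V} (huv : u ≠ v) {F : Matrix V V ℕ} (hf : IsFlow u v F) :
    whittle v F = ∑ w, (F u w : ℤ) * whittle v (F - Matrix.single u w 1) := by
  have hu : rowSum F u = rowSum F.transpose u + 1 := by simpa [huv] using hf u
  set M := rootedLaplacian v F with hMdef
  set P : ℤ := (rowSum F v)! * ∏ i ∈ (univ.erase v).erase u, ((rowSum F i - 1)! : ℤ) with hP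
  have hmem : u ∈ univ.erase v := by simp [huv]
  have hW : whittle v F = M.det * (rowSum F u - 1)! * P := by
    rw [whittle, ← mul_prod_erase _ _ hmem, hP]; ring
  have hrow : M u = (rowSum F u : ℤ) • Pi.single u 1 - fun j => (F u j : ℤ) := by
    funext j
    have : rowSum F u ≠ 0 := by omega
    simp [hMdef, rootedLaplacian, huv, this]
  have hW' (w : V) (h : 0 < F u w) : whittle v (F - Matrix.single u w 1) =
      (rootedLaplacian v (F - Matrix.single u w 1)).det * (rowSum F u - 1 - 1)! * P := by
    rw [whittle, ← mul_prod_erase _ _ hmem, hP, rowSum_sub_single_self h,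
      rowSum_sub_single_ne F huv.symm]
    rw [prod_congr rfl fun i hi => by rw [rowSum_sub_single_ne F (ne_of_mem_erase hi)]]
    ring
  -- `D` is the determinant as a linear function of the row of `u`.
  let D : (V → ℤ) →ₗ[ℤ] ℤ := (LinearMap.proj u).comp (Matrix.cramer M.transpose)
  have hD (x : V → ℤ) : D x = (M.updateRow u x).det := Matrix.cramer_transpose_apply M x u
  have hMu : D (M u) = M.det := by rw [hD, Matrix.updateRow_eq_self]
  have hsum : ∑ w, (F u w : ℤ) • (Pi.single w 1 : V → ℤ) = fun j => (F u j : ℤ) := by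
    funext j
    simp [Finset.sum_apply, Pi.single_apply]
  -- If `u` has a single outgoing transition, its row becomes zero after the removal and is replaced
  -- by a unit vector, so this case is treated separately.
  by_cases h1 : rowSum F u = 1
  · have hcol (i : V) : F i u = 0 := by
      have h0 : rowSum F.transpose u = 0 := by omega
      exact (sum_eq_zero_iff.1 h0) i (mem_univ i)
    have key (w : V) : (F u w : ℤ) * whittle v (F - Matrix.single u w 1) =
        F u w * D (Pi.single u 1 - Pi.single w 1) * P := by
      rcases Nat.eq_zero_or_pos (F u w) with h | h
      · simp [h]
      · have hwu : w ≠ u := by rintro rfl; rw [hcol] at h; omega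
        have hM : rootedLaplacian v (F - Matrix.single u w 1) = M.updateRow u (Pi.single u 1) := by
          ext i j
          by_cases hi : i = u
          · subst hi
            simp [rootedLaplacian, rowSum_sub_single_self h, h1]
          · rw [Matrix.updateRow_ne hi]
            simp only [hMdef, rootedLaplacian, Matrix.of_apply]
            rw [rowSum_sub_single_ne F hi]
            simp [Ne.symm hi]
        -- By the flow condition nothing enters `u`; hence column `u` has its only possible entry in
        -- the row of `u`, which is now $e_w$ with `w ≠ u`.
        have hz : D (Pi.single w 1) = 0 := by
          rw [hD]
          refine Matrix.det_eq_zero_of_column_eq_zero u fun i => ?_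
          by_cases hi : i = u
          · subst hi; simp [hwu.symm]
          · rw [Matrix.updateRow_ne hi]
            simp only [hMdef, rootedLaplacian, Matrix.of_apply]
            split_ifs <;> simp [hcol, Ne.symm hi]
        rw [hW' w h, hM, ← hD, h1, map_sub, hz]
        simp; ring
    simp only [key]
    rw [← sum_mul, hW, h1, ← hMu, hrow, ← hsum]
    have : ∑ w, (F u w : ℤ) = 1 := by rw [← Nat.cast_sum, ← rowSum, h1]; rfl
    simp only [map_sub, map_sum, map_smul, smul_eq_mul, mul_sub, sum_sub_distrib, ← sum_mul, this]
    simp [h1]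
  · have key (w : V) : (F u w : ℤ) * whittle v (F - Matrix.single u w 1) =
        F u w * (D (M u) - D (Pi.single u 1 - Pi.single w 1)) * ((rowSum F u - 1 - 1)! * P) := by
      rcases Nat.eq_zero_or_pos (F u w) with h | h
      · simp [h]
      · have hM : rootedLaplacian v (F - Matrix.single u w 1) =
            M.updateRow u (M u - (Pi.single u 1 - Pi.single w 1)) := by
          ext i j
          by_cases hi : i = u
          · subst hi
            rw [Matrix.updateRow_self, hrow]
            have h2 : rowSum F i - 1 ≠ 0 := by omega
            have h3 : ((rowSum F i - 1 : ℕ) : ℤ) = rowSum F i - 1 := by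
              rw [Nat.cast_sub (by omega)]; rfl
            simp only [rootedLaplacian, Matrix.of_apply, rowSum_sub_single_self h, huv, h2,
              or_self, if_false, h3, Pi.sub_apply, Pi.smul_apply, smul_eq_mul, Matrix.sub_apply,
              Matrix.single_apply, true_and]
            have h4 : (((F i j - if w = j then 1 else 0 : ℕ)) : ℤ) =
                F i j - (Pi.single w 1 : V → ℤ) j := by
              by_cases hj : w = j
              · subst hj; simp; omega
              · simp [hj, Ne.symm hj]
            rw [h4]; ring
          · rw [Matrix.updateRow_ne hi]
            simp only [hMdef, rootedLaplacian, Matrix.of_apply]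
            rw [rowSum_sub_single_ne F hi]
            simp [Ne.symm hi]
        rw [hW' w h, hM, ← hD, map_sub]
        ring
    simp only [key]
    rw [← sum_mul, hW]
    have hs : ∑ w, (F u w : ℤ) = rowSum F u := by rw [rowSum, Nat.cast_sum]
    have h5 : ∑ w, (F u w : ℤ) * (D (M u) - D (Pi.single u 1 - Pi.single w 1)) =
        (rowSum F u - 1) * M.det := by
      have : ∑ w, (F u w : ℤ) * D (Pi.single u 1 - Pi.single w 1) = M.det := by
        rw [← hMu, hrow, ← hsum]
        simp only [map_sub, map_sum, map_smul, smul_eq_mul, mul_sub, sum_sub_distrib, ← sum_mul, hs]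
      simp only [mul_sub, sum_sub_distrib] at this ⊢
      rw [← sum_mul, hs, hMu]
      simp only [map_sub, mul_sub, sum_sub_distrib] at this ⊢
      rw [this]; ring
    rw [h5]
    obtain ⟨m, hm⟩ : ∃ m, rowSum F u = m + 2 := ⟨rowSum F u - 2, by omega⟩
    rw [hm]
    simp only [show m + 2 - 1 = m + 1 by omega, show m + 1 - 1 = m by omega, Nat.factorial_succ]
    push_cast
    ring

theorem whittle_recurrence {u v : V} {F : Matrix V V ℕ} (hF : F ≠ 0) (hf : IsFlow u v F) :
    whittle v F = ∑ w, (F u w : ℤ) * whittle v (F - Matrix.single u w 1) := by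
  by_cases huv : u = v
  · subst huv; exact whittle_recurrence_self hF hf
  · exact whittle_recurrence_ne huv hf

/-- This is the effect of putting the letter `u` in front of a word that starts in `w`. -/
theorem isFlow_add_single {u v w : V} {F : Matrix V V ℕ} :
    IsFlow u v (F + Matrix.single u w 1) ↔ IsFlow w v F := by
  refine forall_congr' fun i => ?_
  rw [Matrix.transpose_add, Matrix.transpose_single, rowSum_add_single, rowSum_add_single]
  omega

/-- The matrices of natural numbers with the sum `m` of entries. -/
def matricesOfSum (V : Type*) [Fintype V] [DecidableEq V] (m : ℕ) : Finset (Matrix V V ℕ) :=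
  (piAntidiag (univ : Finset (V × V)) m).map ((Equiv.curry V V ℕ).trans Matrix.of).toEmbedding

theorem mem_matricesOfSum {m : ℕ} {F : Matrix V V ℕ} :
    F ∈ matricesOfSum V m ↔ ∑ i, rowSum F i = m := by
  simp only [matricesOfSum, mem_map_equiv, mem_piAntidiag, mem_univ, implies_true, and_true,
    rowSum]
  rw [Fintype.sum_prod_type]
  rfl

/-- The monomial `∏ B i j ^ F i j / (F i j)!`. -/
def dividedMonomial {A : Type*} [CommRing A] [Algebra ℚ A] (B : Matrix V V A) (F : Matrix V V ℕ) :
    A := ∏ i, ∏ j, (1 / ((F i j)! : ℚ)) • B i j ^ F i j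

theorem dividedMonomial_add_single {A : Type*} [CommRing A] [Algebra ℚ A] (B : Matrix V V A)
    (F : Matrix V V ℕ) (u w : V) :
    ((F u w : ℚ) + 1) • dividedMonomial B (F + Matrix.single u w 1) =
      B u w * dividedMonomial B F := by
  unfold dividedMonomial
  rw [← prod_product', ← prod_product']
  rw [← mul_prod_erase _ _ (show (u, w) ∈ univ ×ˢ univ by simp),
    ← mul_prod_erase _ _ (show (u, w) ∈ univ ×ˢ univ by simp), ← smul_mul_assoc, ← mul_assoc]
  congr 1
  · have h : (F u w : ℚ) + 1 ≠ 0 := by positivity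
    have h1 : ((F u w)! : ℚ) ≠ 0 := by positivity
    simp only [Matrix.add_apply, Matrix.single_apply_same, Nat.factorial_succ, pow_succ]
    rw [smul_smul, mul_smul_comm]
    congr 1
    · push_cast; field_simp
    · ring
  · refine prod_congr rfl fun x hx => ?_
    have : ¬ (u = x.1 ∧ w = x.2) := fun h => (ne_of_mem_erase hx) (Prod.ext h.1.symm h.2.symm)
    simp [this]

open Classical in
/-- Whittle's formula: the entries of a matrix power, expanded by transition numbers. -/
theorem matrix_pow_apply {A : Type*} [CommRing A] [Algebra ℚ A] (B : Matrix V V A) (m : ℕ)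
    (u v : V) : (B ^ m) u v =
      ∑ F ∈ matricesOfSum V m with IsFlow u v F, (whittle v F : ℚ) • dividedMonomial B F := by
  induction m generalizing u with
  | zero =>
    have h0 : matricesOfSum V 0 = {0} := by
      ext F
      rw [mem_matricesOfSum, mem_singleton]
      constructor
      · intro h
        ext i j
        exact sum_eq_zero_iff.1 (sum_eq_zero_iff.1 h i (mem_univ i)) j (mem_univ j)
      · rintro rfl; simp [rowSum]
    have hflow : IsFlow u v (0 : Matrix V V ℕ) ↔ u = v := by
      constructor
      · intro h
        by_contra hne
        have := h u
        simp [rowSum, hne] at this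
      · rintro rfl i; simp [rowSum]
    have hw : whittle v (0 : Matrix V V ℕ) = 1 := by
      have : rootedLaplacian v (0 : Matrix V V ℕ) = 1 := by
        ext i j
        simp [rootedLaplacian, rowSum, Matrix.one_apply, Pi.single_apply, eq_comm]
      simp [whittle, this, rowSum]
    rw [h0, filter_singleton, pow_zero, Matrix.one_apply]
    by_cases huv : u = v
    · rw [if_pos (hflow.2 huv), if_pos huv, sum_singleton, hw]
      simp [dividedMonomial]
    · simp [hflow, huv]
  | succ m ih =>
    rw [pow_succ', Matrix.mul_apply]
    -- The words are split by their second letter `w`. Adding the transition `u → w` is a bijection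
    -- onto the matrices with `0 < F u w`, and the factor `F u w` lets the others be included.
    have h1 (w : V) : B u w * (B ^ m) w v =
        ∑ F ∈ matricesOfSum V (m + 1) with IsFlow u v F,
          ((F u w : ℚ) * whittle v (F - Matrix.single u w 1)) • dividedMonomial B F := by
      rw [ih w, mul_sum]
      refine Eq.trans ?_ (sum_filter_of_ne (p := fun F => 0 < F u w) ?_)
      · refine sum_bij' (fun F _ => F + Matrix.single u w 1) (fun F _ => F - Matrix.single u w 1)
          ?_ ?_ ?_ ?_ ?_
        · intro F hF
          rw [mem_filter, mem_matricesOfSum] at hF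
          rw [mem_filter, mem_filter, mem_matricesOfSum, isFlow_add_single]
          refine ⟨⟨?_, hF.2⟩, by simp⟩
          simp [rowSum_add_single, sum_add_distrib, hF.1]
        · intro F hF
          rw [mem_filter, mem_filter, mem_matricesOfSum] at hF
          rw [mem_filter, mem_matricesOfSum, ← isFlow_add_single (u := u) (w := w),
            sub_single_add_single hF.2]
          refine ⟨?_, hF.1.2⟩
          have := hF.1.1
          rw [← sub_single_add_single hF.2] at this
          simpa [rowSum_add_single, sum_add_distrib] using this
        · intro F _
          ext i j; simp
        · intro F hF
          exact sub_single_add_single (mem_filter.1 hF).2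
        · intro F _
          have h2 : F + Matrix.single u w 1 - Matrix.single u w 1 = F := by ext i j; simp
          rw [h2, mul_comm (((F + Matrix.single u w 1 : Matrix V V ℕ) u w : ℕ) : ℚ), mul_smul, mul_smul_comm]
          congr 1
          rw [← dividedMonomial_add_single]
          simp
      · intro F _ hne
        by_contra h
        apply hne
        simp [show F u w = 0 by omega]
    simp only [h1]
    rw [sum_comm]
    refine sum_congr rfl fun F hF => ?_
    rw [mem_filter, mem_matricesOfSum] at hF
    have hF0 : F ≠ 0 := by
      rintro rfl
      simp [rowSum] at hF
    rw [← sum_smul, whittle_recurrence hF0 hF.2]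
    push_cast
    rfl

end Whittle

/-! ### The vertex factors as truncated series -/

section Binomial

variable {A : Type*} [CommRing A]

/-- The truncated series `∑ (q + f - 1).choose f * (q + f).choose k * x ^ f`. -/
def binomialSeries (x : A) (L q k : ℕ) : A :=
  ∑ f ∈ range (L + 1), ((q + f - 1).choose f * (q + f).choose k : ℕ) * x ^ f

/-- The polynomial `∑ (k - 1).choose ν * q.choose (k - ν) * x ^ ν`. -/
def binomialPoly (x : A) (q k : ℕ) : A :=
  ∑ ν ∈ range k, ((k - 1).choose ν * q.choose (k - ν) : ℕ) * x ^ ν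

/-- Because `x` is nilpotent, the boundary term of the index shift vanishes, and truncated sums obey
the same recursions as infinite series. -/
theorem sum_range_sub_mul_of_pow_eq_zero {x : A} {L : ℕ} (hx : x ^ (L + 1) = 0) (a b : ℕ → A) :
    ∑ f ∈ range (L + 1), a f * x ^ f - x * ∑ f ∈ range (L + 1), b f * x ^ f =
      a 0 + ∑ f ∈ range L, (a (f + 1) - b f) * x ^ (f + 1) := by
  rw [sum_range_succ', mul_sum, sum_range_succ (fun f => x * (b f * x ^ f))]
  have : x * (b L * x ^ L) = b L * x ^ (L + 1) := by ring
  rw [this, hx]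
  simp only [sub_mul, sum_sub_distrib]
  have : ∑ f ∈ range L, x * (b f * x ^ f) = ∑ f ∈ range L, b f * x ^ (f + 1) :=
    sum_congr rfl fun f _ => by ring
  rw [this]; ring

/-- Pascal's rule is applied to both binomial coefficients. -/
theorem binomialSeries_succ_succ {x : A} {L : ℕ} (hx : x ^ (L + 1) = 0) (q k : ℕ) :
    (1 - x) * binomialSeries x L (q + 1) (k + 1) =
      binomialSeries x L q (k + 1) + binomialSeries x L q k +
        x * binomialSeries x L (q + 1) k := by
  have h : binomialSeries x L (q + 1) (k + 1) - x * ∑ f ∈ range (L + 1),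
      (((q + f).choose f * (q + f + 2).choose (k + 1) : ℕ) : A) * x ^ f =
      binomialSeries x L q (k + 1) + binomialSeries x L q k := by
    have h0 : binomialSeries x L q (k + 1) + binomialSeries x L q k =
        ∑ f ∈ range (L + 1), (((q + f - 1).choose f * (q + f + 1).choose (k + 1) : ℕ) : A) * x ^ f := by
      rw [binomialSeries, binomialSeries, ← sum_add_distrib]
      refine sum_congr rfl fun f _ => ?_
      rw [Nat.choose_succ_succ (q + f) k]
      push_cast; ring
    rw [h0, binomialSeries, sum_range_sub_mul_of_pow_eq_zero hx, sum_range_succ']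
    rw [add_comm]
    congr 1
    · refine sum_congr rfl fun f _ => ?_
      rw [show q + 1 + (f + 1) - 1 = q + f + 1 by omega, show q + (f + 1) - 1 = q + f by omega,
        show q + 1 + (f + 1) = q + f + 2 by omega, show q + (f + 1) + 1 = q + f + 2 by omega,
        Nat.choose_succ_succ (q + f) f]
      push_cast; ring
    · simp
  rw [← h, binomialSeries, binomialSeries]
  have h1 : ∑ f ∈ range (L + 1), (((q + f).choose f * (q + f + 2).choose (k + 1) : ℕ) : A) * x ^ f =
      ∑ f ∈ range (L + 1),
        (((q + 1 + f - 1).choose f * (q + 1 + f).choose (k + 1) : ℕ) : A) * x ^ f +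
      ∑ f ∈ range (L + 1), (((q + 1 + f - 1).choose f * (q + 1 + f).choose k : ℕ) : A) * x ^ f := by
    rw [← sum_add_distrib]
    refine sum_congr rfl fun f _ => ?_
    rw [show q + 1 + f - 1 = q + f by omega, show q + 1 + f = q + f + 1 by omega,
      Nat.choose_succ_succ (q + f + 1) k]
    push_cast; ring
  rw [h1]; ring

/-- This is the truncated binomial series of $(1-x)^{-q}$. -/
theorem binomialSeries_zero_right {x : A} {L : ℕ} (hx : x ^ (L + 1) = 0) (q : ℕ) :
    (1 - x) ^ q * binomialSeries x L q 0 = 1 := by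
  induction q with
  | zero =>
    -- With truncated subtraction the coefficient at `q = 0` is `(f - 1).choose f`, which is `1` for
    -- `f = 0` and `0` otherwise.
    rw [binomialSeries, sum_range_succ', sum_eq_zero]
    · simp
    · intro f _
      simp
  | succ q ih =>
    have h : (1 - x) * binomialSeries x L (q + 1) 0 = binomialSeries x L q 0 := by
      have h1 := sum_range_sub_mul_of_pow_eq_zero hx
        (fun f => (((q + 1 + f - 1).choose f * (q + 1 + f).choose 0 : ℕ) : A))
        (fun f => (((q + 1 + f - 1).choose f * (q + 1 + f).choose 0 : ℕ) : A))
      rw [← binomialSeries] at h1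
      rw [sub_mul, one_mul, h1, binomialSeries, sum_range_succ', add_comm]
      congr 1
      · refine sum_congr rfl fun f _ => ?_
        rw [show q + 1 + (f + 1) - 1 = q + f + 1 by omega, show q + (f + 1) - 1 = q + f by omega,
          show q + 1 + f - 1 = q + f by omega, Nat.choose_succ_succ (q + f) f]
        simp
      · simp
    rw [pow_succ, mul_assoc, h, ih]

/-- This mirrors `binomialSeries_succ_succ` after multiplication by the power of $1-x$ that clears
the denominators. -/
theorem binomialPoly_succ (x : A) (q k : ℕ) :
    binomialPoly x (q + 1) (k + 2) = binomialPoly x q (k + 2) +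
      (1 - x) * binomialPoly x q (k + 1) + x * binomialPoly x (q + 1) (k + 1) := by
  have h1 : binomialPoly x (q + 1) (k + 2) = binomialPoly x q (k + 2) +
      ∑ ν ∈ range (k + 2), (((k + 1).choose ν * q.choose (k + 1 - ν) : ℕ) : A) * x ^ ν := by
    rw [binomialPoly, binomialPoly, ← sum_add_distrib]
    refine sum_congr rfl fun ν hν => ?_
    have := mem_range.1 hν
    rw [show k + 2 - ν = k + 1 - ν + 1 by omega, Nat.choose_succ_succ,
      show k + 2 - 1 = k + 1 by omega]
    push_cast; ring
  have h2 : binomialPoly x (q + 1) (k + 1) = binomialPoly x q (k + 1) +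
      ∑ ν ∈ range (k + 1), ((k.choose ν * q.choose (k - ν) : ℕ) : A) * x ^ ν := by
    rw [binomialPoly, binomialPoly, ← sum_add_distrib]
    refine sum_congr rfl fun ν hν => ?_
    have := mem_range.1 hν
    rw [show k + 1 - ν = k - ν + 1 by omega, Nat.choose_succ_succ, Nat.add_sub_cancel]
    push_cast; ring
  have h3 : binomialPoly x q (k + 1) =
      ∑ ν ∈ range (k + 2), ((k.choose ν * q.choose (k + 1 - ν) : ℕ) : A) * x ^ ν := by
    rw [sum_range_succ, binomialPoly]
    simp
  have h4 : ∑ ν ∈ range (k + 2), (((k + 1).choose ν * q.choose (k + 1 - ν) : ℕ) : A) * x ^ ν =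
      binomialPoly x q (k + 1) +
        x * ∑ ν ∈ range (k + 1), ((k.choose ν * q.choose (k - ν) : ℕ) : A) * x ^ ν := by
    rw [h3, sum_range_succ', sum_range_succ' _ (k + 1), mul_sum, add_right_comm,
      ← sum_add_distrib]
    congr 1
    · refine sum_congr rfl fun ν _ => ?_
      rw [Nat.choose_succ_succ, show k + 1 - (ν + 1) = k - ν by omega]
      push_cast; ring
    · simp
  rw [h1, h4, h2]; ring

theorem pow_mul_binomialSeries {x : A} {L : ℕ} (hx : x ^ (L + 1) = 0) (q k : ℕ) :
    (1 - x) ^ (q + k + 1) * binomialSeries x L q (k + 1) = binomialPoly x q (k + 1) := by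
  induction q generalizing k with
  | zero =>
    have h1 : binomialSeries x L 0 (k + 1) = 0 := by
      refine sum_eq_zero fun f _ => ?_
      rcases f with _ | f <;> simp
    have h2 : binomialPoly x 0 (k + 1) = 0 := by
      refine sum_eq_zero fun ν hν => ?_
      have := mem_range.1 hν
      rw [show k + 1 - ν = k - ν + 1 by omega]
      simp
    rw [h1, h2, mul_zero]
  | succ q ih =>
    induction k with
    | zero =>
      have h0 := binomialSeries_zero_right hx q
      have h1 := binomialSeries_zero_right hx (q + 1)
      have h2 : binomialPoly x (q + 1) 1 = binomialPoly x q 1 + 1 := by simp [binomialPoly]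
      calc _ = (1 - x) ^ (q + 1) * ((1 - x) * binomialSeries x L (q + 1) (0 + 1)) := by ring
        _ = (1 - x) ^ (q + 0 + 1) * binomialSeries x L q (0 + 1) +
            (1 - x) * ((1 - x) ^ q * binomialSeries x L q 0) +
            x * ((1 - x) ^ (q + 1) * binomialSeries x L (q + 1) 0) := by
          rw [binomialSeries_succ_succ hx]; ring
        _ = _ := by rw [ih 0, h0, h1, zero_add, h2]; ring
    | succ k ihk =>
      calc _ = (1 - x) ^ (q + k + 2) * ((1 - x) * binomialSeries x L (q + 1) (k + 1 + 1)) := by ring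
        _ = (1 - x) ^ (q + (k + 1) + 1) * binomialSeries x L q (k + 1 + 1) +
            (1 - x) * ((1 - x) ^ (q + k + 1) * binomialSeries x L q (k + 1)) +
            x * ((1 - x) ^ (q + 1 + k + 1) * binomialSeries x L (q + 1) (k + 1)) := by
          rw [binomialSeries_succ_succ hx]; ring
        _ = _ := by rw [ih, ih, ihk, binomialPoly_succ]

/-- This truncated form of $\sum_f \binom{f}{k} x^{f+1} = (x/(1-x))^{k+1}$ serves the vertex factor
with `q = 0`. -/
theorem pow_mul_sum_choose {x : A} {L : ℕ} (hx : x ^ (L + 1) = 0) (k : ℕ) :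
    (1 - x) ^ (k + 1) * ∑ f ∈ range L, (f.choose k : A) * x ^ (f + 1) = x ^ (k + 1) := by
  induction k with
  | zero =>
    have := mul_neg_geom_sum x L
    simp only [Nat.choose_zero_right, Nat.cast_one, one_mul, pow_succ' x, ← mul_sum]
    calc _ = x * ((1 - x) * ∑ i ∈ range L, x ^ i) := by ring
      _ = x - x ^ (L + 1) := by rw [this]; ring
      _ = _ := by rw [hx]; ring
  | succ k ih =>
    have h := sum_range_sub_mul_of_pow_eq_zero hx (fun f => ((f.choose (k + 1) : ℕ) : A))
      (fun f => ((f.choose (k + 1) : ℕ) : A))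
    have h1 : ∑ f ∈ range L, (f.choose k : A) * x ^ (f + 1) =
        (1 - x) * ∑ f ∈ range (L + 1), ((f.choose (k + 1) : ℕ) : A) * x ^ f := by
      rw [sub_mul, one_mul, h]
      simp [Nat.choose_succ_succ]
    have h2 : x * ∑ f ∈ range (L + 1), ((f.choose (k + 1) : ℕ) : A) * x ^ f =
        ∑ f ∈ range L, (f.choose (k + 1) : A) * x ^ (f + 1) := by
      rw [mul_sum, sum_range_succ]
      have : x * (((L.choose (k + 1) : ℕ) : A) * x ^ L) = 0 := by
        rw [mul_left_comm, ← pow_succ', hx, mul_zero]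
      rw [this, add_zero]
      exact sum_congr rfl fun f _ => by ring
    rw [← h2]
    calc _ = x * ((1 - x) ^ (k + 1) * ((1 - x) *
          ∑ f ∈ range (L + 1), ((f.choose (k + 1) : ℕ) : A) * x ^ f)) := by ring
      _ = _ := by rw [← h1, ih]; ring

end Binomial

/-! ### Power series modulo a power of the variable, and the vertex identity -/

/-- Reduction of power series modulo `X ^ M`. -/
abbrev modXPow {R : Type*} [CommRing R] (M : ℕ) :
    R⟦X⟧ →+* R⟦X⟧ ⧸ Ideal.span {(PowerSeries.X : R⟦X⟧) ^ M} :=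
  Ideal.Quotient.mk _

theorem modXPow_eq_iff {R : Type*} [CommRing R] {M : ℕ} {f g : R⟦X⟧} :
    modXPow M f = modXPow M g ↔ ∀ n < M, PowerSeries.coeff n f = PowerSeries.coeff n g := by
  rw [Ideal.Quotient.eq, Ideal.mem_span_singleton, PowerSeries.X_pow_dvd_iff]
  simp only [map_sub, sub_eq_zero]

theorem modXPow_pow_eq_zero {R : Type*} [CommRing R] {M m : ℕ} (hm : M ≤ m) {f : R⟦X⟧}
    (hf : PowerSeries.constantCoeff f = 0) :
    modXPow M f ^ m = 0 := by
  rw [← map_pow, Ideal.Quotient.eq_zero_iff_mem, Ideal.mem_span_singleton]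
  exact (pow_dvd_pow _ hm).trans (pow_dvd_pow_of_dvd (PowerSeries.X_dvd_iff.2 hf) m)

theorem vertexK_of_pos {q k : ℕ} (hq : 0 < q) (ω : ℂ⟦X⟧) :
    vertexK q (k + 1) ω = ((-1 : ℂ) ^ (k + 1) * (1 / (q : ℂ))) •
      (((1 + ω)⁻¹) ^ (k + 1) * binomialPoly (-ω) q (k + 1)) := by
  rw [vertexK, if_pos hq, binomialPoly]
  congr 2
  have h : range (k + 1) = Icc 0 k := by ext i; simp
  rw [h, Nat.add_sub_cancel, Nat.zero_max]
  -- For `ν < k + 1 - q` the coefficient `q.choose (k + 1 - ν)` vanishes, so the lower limit of the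
  -- sum is immaterial.
  refine sum_subset_zero_on_sdiff (fun i hi => ?_) (fun i hi => ?_) (fun i _ => ?_)
  · simp only [mem_Icc] at hi ⊢; omega
  · rw [mem_sdiff, mem_Icc, mem_Icc] at hi
    rw [Nat.choose_eq_zero_of_lt (show q < k + 1 - i by omega)]; simp
  · rw [Algebra.smul_def]; push_cast; simp

/-- Here `f` is the number of loops at a vertex that has `q` other outgoing transitions, and `ω` is
the weight of a loop. With $x = -\omega$, nilpotent modulo $X^{L+1}$, the sum is a multiple of
`binomialSeries` if `q > 0`, and of the sum in `pow_mul_sum_choose` if `q = 0`. -/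
theorem vertex_identity {ω : ℂ⟦X⟧} (hω : PowerSeries.constantCoeff ω = 0) (L q : ℕ) {k : ℕ}
    (hk : 0 < k) :
    modXPow (L + 1) (∑ f ∈ range (L + 1),
      ((-1 : ℂ) ^ (q + f + k) * ((q + f - 1)! : ℂ) * ((q + f).choose k : ℂ) / (f ! : ℂ)) • ω ^ f) =
    modXPow (L + 1) (((-1 : ℂ) ^ q * (q ! : ℂ)) • (((1 + ω)⁻¹) ^ q * vertexK q k ω)) := by
  obtain ⟨k, rfl⟩ := Nat.exists_eq_succ_of_ne_zero hk.ne'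
  simp only [Nat.succ_eq_add_one]
  have hx : modXPow (L + 1) (-ω) ^ (L + 1) = 0 :=
    modXPow_pow_eq_zero le_rfl (by simpa using hω)
  have hinv : (1 + ω)⁻¹ * (1 + ω) = 1 := PowerSeries.inv_mul_cancel _ (by simp [hω])
  -- Division by $(1-x)^m = (1+\omega)^m$.
  have cancel (m : ℕ) {f g : ℂ⟦X⟧} (h : (1 - modXPow (L + 1) (-ω)) ^ m * modXPow (L + 1) f =
      modXPow (L + 1) g) : modXPow (L + 1) f = modXPow (L + 1) (((1 + ω)⁻¹) ^ m * g) := by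
    rw [map_mul, ← h, ← map_one (modXPow (L + 1)), ← map_sub, ← map_pow, ← map_mul, ← map_mul]
    congr 1
    rw [sub_neg_eq_add, ← mul_assoc, ← mul_pow, hinv, one_pow, one_mul]
  rcases Nat.eq_zero_or_pos q with rfl | hq
  · have h1 : ∑ f ∈ range (L + 1), ((-1 : ℂ) ^ (0 + f + (k + 1)) * ((0 + f - 1)! : ℂ) *
        ((0 + f).choose (k + 1) : ℂ) / (f ! : ℂ)) • ω ^ f =
        ((-1 : ℂ) ^ (k + 1) / (k + 1)) •
          ∑ f ∈ range L, (f.choose k : ℂ⟦X⟧) * (-ω) ^ (f + 1) := by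
      rw [sum_range_succ', smul_sum]
      simp only [zero_add, Nat.choose_zero_succ, Nat.cast_zero, mul_zero, zero_div, zero_smul,
        add_zero, Nat.add_sub_cancel]
      refine sum_congr rfl fun f _ => ?_
      -- The quotient $(f)!/(f+1)! = 1/(f+1)$ of the factorials is absorbed by the binomial
      -- coefficient; this leaves the $1/k$ of the vertex factor.
      have h2 : ((f : ℂ) + 1) * (f.choose k : ℂ) = ((f + 1).choose (k + 1) : ℂ) * (k + 1) := by
        exact_mod_cast Nat.add_one_mul_choose_eq f k
      have h3 : ((f : ℂ) + 1) ≠ 0 := by exact_mod_cast Nat.succ_ne_zero f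
      have h4 : ((k : ℂ) + 1) ≠ 0 := by exact_mod_cast Nat.succ_ne_zero k
      have h5 : (f ! : ℂ) ≠ 0 := by exact_mod_cast Nat.factorial_ne_zero f
      have h6 : ((f + 1).choose (k + 1) : ℂ) = (f + 1) * f.choose k / (k + 1) := by
        rw [eq_div_iff h4, h2]
      rw [neg_pow ω, ← map_natCast (PowerSeries.C (R := ℂ)), ← PowerSeries.smul_eq_C_mul,
        show ((-1 : ℂ⟦X⟧) ^ (f + 1) * ω ^ (f + 1)) = ((-1 : ℂ) ^ (f + 1)) • ω ^ (f + 1) by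
          rw [PowerSeries.smul_eq_C_mul]; simp, smul_smul, smul_smul, h6, Nat.factorial_succ]
      congr 1
      push_cast
      field_simp
      ring
    rw [h1, vertexK, if_neg (lt_irrefl 0)]
    simp only [pow_zero, Nat.factorial_zero, Nat.cast_one, one_mul, one_smul]
    have h2 := cancel (k + 1) (f := ∑ f ∈ range L, (f.choose k : ℂ⟦X⟧) * (-ω) ^ (f + 1))
      (g := (-ω) ^ (k + 1)) (by simpa using pow_mul_sum_choose hx k)
    rw [PowerSeries.smul_eq_C_mul, map_mul, h2, ← map_mul, ← PowerSeries.smul_eq_C_mul]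
    congr 1
    rw [neg_pow ω, show ((-1 : ℂ⟦X⟧) ^ (k + 1) * ω ^ (k + 1)) = ((-1 : ℂ) ^ (k + 1)) • ω ^ (k + 1) by
      rw [PowerSeries.smul_eq_C_mul]; simp, mul_smul_comm, smul_smul, mul_pow, mul_comm (ω ^ (k + 1))]
    congr 1
    rw [div_mul_eq_mul_div, ← mul_pow]
    simp
  · have h1 : ∑ f ∈ range (L + 1), ((-1 : ℂ) ^ (q + f + (k + 1)) * ((q + f - 1)! : ℂ) *
        ((q + f).choose (k + 1) : ℂ) / (f ! : ℂ)) • ω ^ f =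
        ((-1 : ℂ) ^ (q + k + 1) * ((q - 1)! : ℂ)) • binomialSeries (-ω) L q (k + 1) := by
      rw [binomialSeries, smul_sum]
      refine sum_congr rfl fun f _ => ?_
      have h2 : ((q + f - 1).choose f : ℂ) * (f ! : ℂ) * ((q - 1)! : ℂ) = ((q + f - 1)! : ℂ) := by
        have := Nat.choose_mul_factorial_mul_factorial (show f ≤ q + f - 1 by omega)
        rw [show q + f - 1 - f = q - 1 by omega] at this
        exact_mod_cast this
      have h5 : (f ! : ℂ) ≠ 0 := by exact_mod_cast Nat.factorial_ne_zero f
      rw [neg_pow ω, ← map_natCast (PowerSeries.C (R := ℂ)), ← PowerSeries.smul_eq_C_mul,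
        show ((-1 : ℂ⟦X⟧) ^ f * ω ^ f) = ((-1 : ℂ) ^ f) • ω ^ f by
          rw [PowerSeries.smul_eq_C_mul]; simp, smul_smul, smul_smul, ← h2]
      congr 1
      push_cast
      field_simp
      ring
    rw [h1, vertexK_of_pos hq]
    have h2 := cancel (q + k + 1) (f := binomialSeries (-ω) L q (k + 1))
      (g := binomialPoly (-ω) q (k + 1)) (by
        have := pow_mul_binomialSeries hx q k
        simpa [binomialSeries, binomialPoly] using this)
    rw [PowerSeries.smul_eq_C_mul, map_mul, h2, ← map_mul, ← PowerSeries.smul_eq_C_mul,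
      mul_smul_comm, smul_smul, ← mul_assoc ((1 + ω)⁻¹ ^ q), ← pow_add, add_assoc]
    congr 2
    obtain ⟨m, rfl⟩ := Nat.exists_eq_succ_of_ne_zero hq.ne'
    have h4 : ((m : ℂ) + 1) ≠ 0 := by exact_mod_cast Nat.succ_ne_zero m
    rw [Nat.succ_eq_add_one, Nat.add_sub_cancel, Nat.factorial_succ]
    push_cast
    field_simp
    ring

/-! ### Walks with weighted points -/

theorem walkCount_neg {d : ℕ} (n : ℕ) (p : Lattice d) : walkCount n (-p) = walkCount n p := by
  induction n generalizing p with
  | zero => simp [walkCount]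
  | succ n ih =>
    simp only [walkCount]
    refine Fintype.sum_equiv ((Equiv.refl (Fin d)).prodCongr (Equiv.neg ℤˣ)) _ _ fun s => ?_
    rw [← ih]
    congr 1
    simp [Step.vec, Pi.single_neg]
    abel

/-- A walk is cut after `i` steps; `Ω` only has to contain all possible cut points. -/
theorem walkCount_add {d : ℕ} (i j : ℕ) (a b : Lattice d) (Ω : Finset (Lattice d))
    (hΩ : ∀ p, walkCount i (p - a) ≠ 0 → p ∈ Ω) :
    ∑ p ∈ Ω, walkCount i (p - a) * walkCount j (b - p) = walkCount (i + j) (b - a) := by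
  induction i generalizing a with
  | zero =>
    rw [sum_eq_single a]
    · simp [walkCount]
    · intro p _ hp
      simp [walkCount, sub_eq_zero, hp]
    · intro h
      exact absurd (hΩ a (by simp [walkCount])) h
  | succ i ih =>
    rw [Nat.succ_add]
    simp only [walkCount, sum_mul]
    rw [sum_comm]
    refine sum_congr rfl fun s _ => ?_
    rw [sub_sub b, ← ih (a + s.vec)]
    · simp only [sub_sub]
    · intro p hp
      refine hΩ p ?_
      rw [← sub_sub] at hp
      rw [walkCount]
      exact fun h => hp (sum_eq_zero_iff.1 h s (mem_univ s))

theorem finite_walkCount_ne_zero {d : ℕ} (n : ℕ) : {p : Lattice d | walkCount n p ≠ 0}.Finite := by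
  induction n with
  | zero =>
    refine (Set.finite_singleton (0 : Lattice d)).subset fun p hp => ?_
    simpa [walkCount] using hp
  | succ n ih =>
    refine (Set.finite_iUnion fun s : Step d => ih.image (· + s.vec)).subset fun p hp => ?_
    obtain ⟨s, -, hs⟩ := exists_ne_zero_of_sum_ne_zero (show ∑ s : Step d, _ ≠ 0 from hp)
    exact Set.mem_iUnion.2 ⟨s, p - s.vec, hs, sub_add_cancel _ _⟩

section Weights

variable {d r : ℕ} {R : Type*} [CommRing R]

/-- The sum over the walks of length `n` from `p` to `q` of the products of the weights of their
points, the last point excluded. -/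
def weightSum (lam : Lattice d → R) : ℕ → Lattice d → Lattice d → R
  | 0, p, q => if p = q then 1 else 0
  | n + 1, p, q => lam p * ∑ s : Step d, weightSum lam n (p + s.vec) q

/-- The weight that is `1 + t a` at `Y a`, and `1` elsewhere (for injective `Y`). -/
def perturbedWeight (Y : Fin r → Lattice d) (t : Fin r → R) (p : Lattice d) : R :=
  1 + ∑ a, if p = Y a then t a else 0

/-- In the product of the factors `1 + t a`, the last factor from which `t a` is chosen is singled
out. Up to it the walk keeps its full weight, after it the walk is free. The free part is nonempty
because the end point carries no weight. -/
theorem weightSum_perturbed (Y : Fin r → Lattice d) (t : Fin r → R) (n : ℕ) (p q : Lattice d) :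
    weightSum (perturbedWeight Y t) n p q = walkCount n (q - p) +
      ∑ a, ∑ ij ∈ antidiagonal n,
        weightSum (perturbedWeight Y t) ij.1 p (Y a) * (t a * stepCount ij.2 (q - Y a)) := by
  induction n generalizing p with
  | zero =>
    have : q - p = 0 ↔ p = q := by rw [sub_eq_zero, eq_comm]
    simp [weightSum, walkCount, stepCount, this]
  | succ n ih =>
    have h0 : ∑ a, (if p = Y a then (1 : R) else 0) * (t a * stepCount (n + 1) (q - Y a)) =
        (∑ a, if p = Y a then t a else 0) * walkCount (n + 1) (q - p) := by
      rw [sum_mul]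
      refine sum_congr rfl fun a _ => ?_
      split_ifs with h
      · subst h; simp [stepCount]
      · simp
    have h1 : ∑ s : Step d, (walkCount n (q - (p + s.vec)) : R) = walkCount (n + 1) (q - p) := by
      simp [walkCount, sub_sub]
    -- The index `(0, n + 1)` means that the last choice falls on the starting point; in all other
    -- terms the first step can be split off.
    have h2 (a : Fin r) : ∑ ij ∈ antidiagonal (n + 1),
        weightSum (perturbedWeight Y t) ij.1 p (Y a) * (t a * stepCount ij.2 (q - Y a)) =
        (if p = Y a then 1 else 0) * (t a * stepCount (n + 1) (q - Y a)) +
        perturbedWeight Y t p * ∑ s : Step d, ∑ ij ∈ antidiagonal n,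
          weightSum (perturbedWeight Y t) ij.1 (p + s.vec) (Y a) *
            (t a * stepCount ij.2 (q - Y a)) := by
      rw [Finset.Nat.sum_antidiagonal_succ]
      congr 1
      rw [sum_comm, mul_sum]
      refine sum_congr rfl fun ij _ => ?_
      rw [weightSum, ← sum_mul, mul_assoc]
    simp only [h2, sum_add_distrib, h0]
    rw [weightSum]
    simp only [fun s : Step d => ih (p + s.vec), sum_add_distrib, h1]
    rw [sum_comm, mul_add, ← mul_sum, perturbedWeight]
    ring

/-! ### The renewal equation for generating series -/

/-- The generating series of the walks from `0` to `p`. -/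
def walkSeries (R : Type*) [CommRing R] (p : Lattice d) : R⟦X⟧ :=
  PowerSeries.mk fun n => (walkCount n p : R)

/-- The generating series of the nonempty walks from `0` to `p`. -/
def stepSeries (R : Type*) [CommRing R] (p : Lattice d) : R⟦X⟧ :=
  PowerSeries.mk fun n => (stepCount n p : R)

theorem constantCoeff_stepSeries (p : Lattice d) :
    PowerSeries.constantCoeff (stepSeries R p) = 0 := by
  simp [← PowerSeries.coeff_zero_eq_constantCoeff_apply, stepSeries, stepCount]

/-- The generating series of weighted walks. -/
def weightSeries (Y : Fin r → Lattice d) (t : Fin r → R) (p q : Lattice d) : R⟦X⟧ :=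
  PowerSeries.mk fun n => weightSum (perturbedWeight Y t) n p q

theorem weightSeries_eq (Y : Fin r → Lattice d) (t : Fin r → R) (p q : Lattice d) :
    weightSeries Y t p q = walkSeries R (q - p) +
      ∑ a, weightSeries Y t p (Y a) * (PowerSeries.C (t a) * stepSeries R (q - Y a)) := by
  ext n
  simp only [weightSeries, walkSeries, stepSeries, map_add, map_sum, PowerSeries.coeff_mk]
  rw [weightSum_perturbed]
  congr 1
  refine sum_congr rfl fun a _ => ?_
  rw [PowerSeries.coeff_mul]
  simp only [PowerSeries.coeff_C_mul, PowerSeries.coeff_mk]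

/-- The transition matrix between the points `Y`. -/
def transitionMatrix (Y : Fin r → Lattice d) (t : Fin r → R) : Matrix (Fin r) (Fin r) R⟦X⟧ :=
  Matrix.of fun a b => PowerSeries.C (t a) * stepSeries R (Y b - Y a)

/-- The renewal equation $v = u + vB$ is iterated: a finite Neumann series with remainder. -/
theorem weightSeries_eq_vecMul (Y : Fin r → Lattice d) (t : Fin r → R) (p : Lattice d) (M : ℕ) :
    (fun a => weightSeries Y t p (Y a)) =
      Matrix.vecMul (fun a => walkSeries R (Y a - p)) (∑ m ∈ range M, transitionMatrix Y t ^ m) +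
      Matrix.vecMul (fun a => weightSeries Y t p (Y a)) (transitionMatrix Y t ^ M) := by
  induction M with
  | zero => simp
  | succ M ih =>
    have h : (fun a => weightSeries Y t p (Y a)) = (fun a => walkSeries R (Y a - p)) +
        Matrix.vecMul (fun a => weightSeries Y t p (Y a)) (transitionMatrix Y t) := by
      funext b
      rw [weightSeries_eq]
      rfl
    rw [sum_range_succ, Matrix.vecMul_add, pow_succ', ← Matrix.vecMul_vecMul, add_assoc]
    rw [← Matrix.add_vecMul, ← h]
    exact ih

theorem modXPow_transitionMatrix_pow (Y : Fin r → Lattice d) (t : Fin r → R) (M m : ℕ) (hm : M ≤ m)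
    (a b : Fin r) : modXPow M ((transitionMatrix Y t ^ m) a b) = 0 := by
  have h : PowerSeries.X ^ m ∣ (transitionMatrix Y t ^ m) a b := by
    clear hm
    induction m generalizing a with
    | zero => simp
    | succ m ih =>
      rw [pow_succ' (transitionMatrix Y t), Matrix.mul_apply, pow_succ']
      refine dvd_sum fun c _ => mul_dvd_mul ?_ (ih c)
      exact Dvd.dvd.mul_left (PowerSeries.X_dvd_iff.2 (constantCoeff_stepSeries _)) _
  rw [Ideal.Quotient.eq_zero_iff_mem, Ideal.mem_span_singleton]
  exact (pow_dvd_pow _ hm).trans h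

/-! ### Derivatives of traces of matrix powers -/

theorem map_derivation_mul {n A : Type*} [Fintype n] [CommRing A] [Algebra R A]
    (D : Derivation R A A) (B C : Matrix n n A) :
    (B * C).map D = B.map D * C + B * C.map D := by
  ext i j
  simp only [Matrix.map_apply, Matrix.mul_apply, Matrix.add_apply, map_sum, Derivation.leibniz,
    smul_eq_mul, ← sum_add_distrib]
  exact sum_congr rfl fun k _ => by ring

/-- The extra factor `B ^ j` makes the induction work: it collects the powers that the Leibniz rule
and the cyclicity of the trace move aside. -/
theorem trace_map_derivation_pow_mul {n A : Type*} [Fintype n] [DecidableEq n] [CommRing A]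
    [Algebra R A] (D : Derivation R A A) (B : Matrix n n A) (m j : ℕ) :
    ((B ^ m).map D * B ^ j).trace = m * (B ^ (m + j - 1) * B.map D).trace := by
  induction m generalizing j with
  | zero =>
    have : ((1 : Matrix n n A).map D) = 0 := by
      ext i k
      by_cases h : i = k
      · subst h; simp
      · simp [h]
    simp [this]
  | succ m ih =>
    rw [pow_succ, map_derivation_mul, add_mul, Matrix.trace_add, mul_assoc, ← pow_succ', ih,
      mul_assoc, Matrix.trace_mul_comm (B ^ m), mul_assoc, ← pow_add,
      Matrix.trace_mul_comm (B.map D), show m + (j + 1) - 1 = m + j by omega,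
      show m + 1 + j - 1 = m + j by omega, add_comm j m]
    push_cast; ring

theorem derivation_trace_pow {n A : Type*} [Fintype n] [DecidableEq n] [CommRing A]
    [Algebra R A] (D : Derivation R A A) (B : Matrix n n A) (m : ℕ) :
    D (B ^ (m + 1)).trace = (m + 1) * (B ^ m * B.map D).trace := by
  have := trace_map_derivation_pow_mul D B (m + 1) 0
  rw [pow_zero, mul_one] at this
  simp only [Matrix.trace, Matrix.diag, map_sum] at this ⊢
  simpa using this

/-- The points reached from the points `Y` in less than `M` steps. -/
def reachable (Y : Fin r → Lattice d) (M : ℕ) : Finset (Lattice d) :=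
  (Set.Finite.toFinset (s := ⋃ a, ⋃ i : Fin M, {p | walkCount i (p - Y a) ≠ 0})
    (Set.finite_iUnion fun _ => Set.finite_iUnion fun i =>
      (finite_walkCount_ne_zero (i : ℕ)).preimage (sub_left_injective.injOn)))

theorem mem_reachable {Y : Fin r → Lattice d} {M : ℕ} {p : Lattice d} :
    p ∈ reachable Y M ↔ ∃ a, ∃ i < M, walkCount i (p - Y a) ≠ 0 := by
  simp [reachable, Fin.exists_iff]

/-- No marked point has a short walk to `p`, so the renewal terms vanish and the marks have no
effect. This permits finite sums over the starting points. -/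
theorem weightSum_of_notMem_reachable (Y : Fin r → Lattice d) (t : Fin r → R) {n M : ℕ}
    (hn : n < M) {p : Lattice d} (hp : p ∉ reachable Y M) (q : Lattice d) :
    weightSum (perturbedWeight Y t) n q p = walkCount n (p - q) := by
  rw [weightSum_perturbed, sum_eq_zero, add_zero]
  refine fun a _ => sum_eq_zero fun ij hij => ?_
  have h : stepCount ij.2 (p - Y a) = 0 := by
    by_contra h
    refine hp (mem_reachable.2 ⟨a, ij.2, ?_, fun h0 => h ?_⟩)
    · have := HasAntidiagonal.mem_antidiagonal.1 hij; omega
    · simp [stepCount, h0]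
  rw [h]; simp

/-- A walk of length `n` from `Y a` to `Y b` is cut at a point `p` after at least one step. There
are `n` places for the cut, hence the operator $X\,d/dX$. -/
theorem modXPow_sum_walkSeries_mul (Y : Fin r → Lattice d) (M : ℕ) (a b : Fin r) :
    modXPow M (∑ p ∈ reachable Y M, walkSeries R (Y b - p) * stepSeries R (p - Y a)) =
      modXPow M ((PowerSeries.X : R⟦X⟧) * PowerSeries.derivative R (stepSeries R (Y b - Y a))) := by
  rw [modXPow_eq_iff]
  intro n hn
  have hR : PowerSeries.coeff n
      ((PowerSeries.X : R⟦X⟧) * PowerSeries.derivative R (stepSeries R (Y b - Y a))) = n * walkCount n (Y b - Y a) := by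
    rcases n with _ | n
    · simp
    · rw [PowerSeries.coeff_succ_X_mul, PowerSeries.coeff_derivative, stepSeries,
        PowerSeries.coeff_mk, stepCount, if_neg (Nat.succ_ne_zero n)]
      push_cast; ring
  rw [hR, map_sum]
  simp only [PowerSeries.coeff_mul, walkSeries, stepSeries, PowerSeries.coeff_mk]
  rw [sum_comm]
  have key : ∀ ij ∈ antidiagonal n, ∑ p ∈ reachable Y M,
      (walkCount ij.1 (Y b - p) : R) * (stepCount ij.2 (p - Y a) : R) =
      if ij.2 = 0 then 0 else (walkCount n (Y b - Y a) : R) := by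
    intro ij hij
    have h := HasAntidiagonal.mem_antidiagonal.1 hij
    by_cases h0 : ij.2 = 0
    · simp [stepCount, h0]
    · rw [if_neg h0, ← h, add_comm ij.1, ← walkCount_add ij.2 ij.1 (Y a) (Y b) (reachable Y M)]
      · push_cast
        refine sum_congr rfl fun p _ => ?_
        rw [stepCount, if_neg h0, mul_comm]
      · exact fun p hp => mem_reachable.2 ⟨a, ij.2, by omega, hp⟩
  rw [sum_congr rfl key]
  -- Of the `n + 1` splittings only the one with empty first part is excluded.
  rw [Finset.Nat.sum_antidiagonal_eq_sum_range_succ (fun _ j => if j = 0 then (0 : R) else _)]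
  rw [sum_range_succ, Nat.sub_self, if_pos rfl, add_zero,
    sum_congr rfl (fun i hi => if_neg (by have := mem_range.1 hi; omega))]
  simp

/-- The number of closed walks with weighted points, as the derivative of the logarithm of a
determinant. -/
theorem sum_weightSum_sub [Algebra ℚ R] (Y : Fin r → Lattice d) (t : Fin r → R) {n M : ℕ}
    (hn : n < M) :
    ∑ p ∈ reachable Y M, (weightSum (perturbedWeight Y t) n p p - walkCount n (0 : Lattice d)) =
      n * PowerSeries.coeff n (∑ m ∈ range M,
        (1 / ((m : ℚ) + 1)) • (transitionMatrix Y t ^ (m + 1)).trace) := by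
  set B := transitionMatrix Y t with hB
  set D := PowerSeries.derivative R
  -- The Neumann series is inserted into the renewal equation for the closed walks at `p`.
  have h1 (p : Lattice d) : modXPow M (weightSeries Y t p p - walkSeries R (0 : Lattice d)) =
      modXPow M (∑ m ∈ range M, ∑ a, ∑ b, (B ^ m) b a *
        (PowerSeries.C (t a) * (walkSeries R (Y b - p) * stepSeries R (p - Y a)))) := by
    rw [weightSeries_eq, sub_self, add_sub_cancel_left]
    simp only [map_sum, map_mul]
    rw [sum_comm]
    refine sum_congr rfl fun a _ => ?_
    have h := congrFun (weightSeries_eq_vecMul Y t p M) a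
    rw [← hB] at h
    rw [h, Pi.add_apply, map_add]
    have hz : modXPow M (Matrix.vecMul (fun a => weightSeries Y t p (Y a)) (B ^ M) a) = 0 := by
      rw [Matrix.vecMul, dotProduct, map_sum]
      refine sum_eq_zero fun b _ => ?_
      rw [map_mul, modXPow_transitionMatrix_pow Y t M M le_rfl, mul_zero]
    rw [hz, add_zero, Matrix.vecMul_sum, Finset.sum_apply, map_sum, sum_mul]
    refine sum_congr rfl fun m _ => ?_
    rw [Matrix.vecMul, dotProduct, map_sum, sum_mul]
    refine sum_congr rfl fun b _ => ?_
    rw [map_mul]; ring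
  have h2 : modXPow M (∑ p ∈ reachable Y M,
      (weightSeries Y t p p - walkSeries R (0 : Lattice d))) =
      modXPow M (PowerSeries.X * D (∑ m ∈ range M, (1 / ((m : ℚ) + 1)) • (B ^ (m + 1)).trace)) := by
    rw [map_sum, sum_congr rfl fun p _ => h1 p, ← map_sum, sum_comm]
    rw [map_sum D, mul_sum, map_sum, map_sum]
    refine sum_congr rfl fun m _ => ?_
    -- The logarithmic weight $1/(m+1)$ cancels the factor from the derivative of the trace.
    have h3 : D ((1 / ((m : ℚ) + 1)) • (B ^ (m + 1)).trace) = (B ^ m * B.map D).trace := by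
      have hm : ((m : ℚ) + 1) ≠ 0 := by positivity
      rw [show D ((1 / ((m : ℚ) + 1)) • (B ^ (m + 1)).trace) =
        (1 / ((m : ℚ) + 1)) • D (B ^ (m + 1)).trace from map_rat_smul D _ _, derivation_trace_pow]
      rw [show ((m : R⟦X⟧) + 1) * (B ^ m * B.map D).trace =
        ((m : ℚ) + 1) • (B ^ m * B.map D).trace by
          rw [add_smul, one_smul, add_mul, one_mul, Nat.cast_smul_eq_nsmul, nsmul_eq_mul]]
      rw [smul_smul, one_div, inv_mul_cancel₀ hm, one_smul]
    have h6 : ∑ p ∈ reachable Y M, ∑ a, ∑ b, (B ^ m) b a *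
        (PowerSeries.C (t a) * (walkSeries R (Y b - p) * stepSeries R (p - Y a))) =
        ∑ a, ∑ b, (B ^ m) b a * (PowerSeries.C (t a) *
          ∑ p ∈ reachable Y M, walkSeries R (Y b - p) * stepSeries R (p - Y a)) := by
      rw [sum_comm]
      refine sum_congr rfl fun a _ => ?_
      rw [sum_comm]
      simp only [mul_sum]
    have h7 : PowerSeries.X * (B ^ m * B.map D).trace =
        ∑ a, ∑ b, (B ^ m) b a * (PowerSeries.C (t a) *
          (PowerSeries.X * D (stepSeries R (Y b - Y a)))) := by
      simp only [Matrix.trace, Matrix.diag, Matrix.mul_apply, mul_sum]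
      rw [sum_comm]
      refine sum_congr rfl fun a _ => sum_congr rfl fun b _ => ?_
      have : D (B a b) = PowerSeries.C (t a) * D (stepSeries R (Y b - Y a)) := by
        rw [hB, transitionMatrix, Matrix.of_apply, ← PowerSeries.smul_eq_C_mul, Derivation.map_smul,
          PowerSeries.smul_eq_C_mul]
      rw [Matrix.map_apply, this]; ring
    rw [h3, h6, h7]
    simp only [map_sum, map_mul]
    refine sum_congr rfl fun a _ => sum_congr rfl fun b _ => ?_
    rw [← map_mul (modXPow M) PowerSeries.X, ← modXPow_sum_walkSeries_mul, map_sum]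
    simp only [map_mul]
  have h4 := modXPow_eq_iff.1 h2 n hn
  have h5 : PowerSeries.coeff n (∑ p ∈ reachable Y M,
      (weightSeries Y t p p - walkSeries R (0 : Lattice d))) =
      ∑ p ∈ reachable Y M, (weightSum (perturbedWeight Y t) n p p - walkCount n (0 : Lattice d)) := by
    simp only [weightSeries, walkSeries, map_sum, map_sub, PowerSeries.coeff_mk]
  rw [← h5, h4]
  rcases n with _ | n
  · simp
  · rw [PowerSeries.coeff_succ_X_mul, PowerSeries.coeff_derivative]
    push_cast; ring

end Weights

/-! ### Sums over matrices of transition numbers -/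

section Extraction

variable {r : ℕ}

/-- The coefficient of a monomial in each coefficient of a power series. -/
def extract (κ : Fin r →₀ ℕ) : (MvPolynomial (Fin r) ℂ)⟦X⟧ →+ ℂ⟦X⟧ where
  toFun f := PowerSeries.mk fun n => MvPolynomial.coeff κ (PowerSeries.coeff n f)
  map_zero' := by ext n; simp
  map_add' f g := by ext n; simp

theorem coeff_extract (κ : Fin r →₀ ℕ) (f : (MvPolynomial (Fin r) ℂ)⟦X⟧) (n : ℕ) :
    PowerSeries.coeff n (extract κ f) = MvPolynomial.coeff κ (PowerSeries.coeff n f) := by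
  simp [extract]

theorem extract_C_mul_map (κ : Fin r →₀ ℕ) (P : MvPolynomial (Fin r) ℂ) (g : ℂ⟦X⟧) :
    extract κ (PowerSeries.C P * PowerSeries.map MvPolynomial.C g) =
      MvPolynomial.coeff κ P • g := by
  ext n
  rw [coeff_extract, PowerSeries.coeff_C_mul, PowerSeries.coeff_map, mul_comm P,
    MvPolynomial.coeff_C_mul, PowerSeries.coeff_smul, smul_eq_mul, mul_comm]

theorem coeff_prod_X_sub_one_pow (h : Fin r → ℕ) (κ : Fin r →₀ ℕ) :
    MvPolynomial.coeff κ (∏ a, (MvPolynomial.X a - 1 : MvPolynomial (Fin r) ℂ) ^ h a) =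
      ∏ a, (-1 : ℂ) ^ (h a + κ a) * ((h a).choose (κ a) : ℂ) := by
  have h1 (a : Fin r) : (MvPolynomial.X a - 1 : MvPolynomial (Fin r) ℂ) ^ h a =
      ∑ j ∈ range (h a + 1),
        MvPolynomial.C ((-1 : ℂ) ^ (h a + j) * ((h a).choose j : ℂ)) * MvPolynomial.X a ^ j := by
    rw [sub_pow]
    refine sum_congr rfl fun j _ => ?_
    simp only [map_mul, map_pow, map_neg, map_one, map_natCast, one_pow]
    ring_nf
  simp only [h1]
  rw [prod_univ_sum, MvPolynomial.coeff_sum]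
  have h2 (f : Fin r → ℕ) : MvPolynomial.coeff κ (∏ a,
      MvPolynomial.C ((-1 : ℂ) ^ (h a + f a) * ((h a).choose (f a) : ℂ)) *
        MvPolynomial.X a ^ f a) =
      if f = κ then ∏ a, (-1 : ℂ) ^ (h a + κ a) * ((h a).choose (κ a) : ℂ) else 0 := by
    have hm : ∏ a, (MvPolynomial.X a : MvPolynomial (Fin r) ℂ) ^ f a =
        MvPolynomial.monomial (Finsupp.equivFunOnFinite.symm f) 1 := by
      rw [MvPolynomial.monomial_eq, Finsupp.prod_fintype _ _ (by simp)]
      simp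
    rw [prod_mul_distrib, ← map_prod, MvPolynomial.coeff_C_mul, hm, MvPolynomial.coeff_monomial]
    by_cases hf : f = κ
    · rw [if_pos hf, if_pos (by ext a; simp [hf]), mul_one, hf]
    · rw [if_neg hf, if_neg (fun h => hf (by funext a; simpa using DFunLike.congr_fun h a)),
        mul_zero]
  simp only [h2]
  rw [sum_ite_eq']
  split_ifs with hmem
  · rfl
  -- Outside the box some `κ a` exceeds `h a`, and the claimed product vanishes as well.
  · rw [Fintype.mem_piFinset] at hmem
    push Not at hmem
    obtain ⟨a, ha⟩ := hmem
    symm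
    refine prod_eq_zero (mem_univ a) ?_
    rw [Nat.choose_eq_zero_of_lt (by simpa using ha)]
    simp

end Extraction

/-! ### Closed words: circulations, cofactors and loops -/

section Circulations

variable {r : ℕ}

/-- `F` has equal row sums and column sums. -/
def IsCirculation (F : Matrix (Fin r) (Fin r) ℕ) : Prop :=
  ∀ i, rowSum F i = rowSum F.transpose i

theorem isFlow_self_iff {u : Fin r} {F : Matrix (Fin r) (Fin r) ℕ} :
    IsFlow u u F ↔ IsCirculation F :=
  forall_congr' fun _ => Nat.add_right_cancel_iff

theorem sum_laplacian (F : Matrix (Fin r) (Fin r) ℕ) (i : Fin r) :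
    ∑ j, laplacian (rowSum F) F i j = 0 := by
  simp [laplacian, Finset.sum_sub_distrib, Matrix.diagonal_apply, rowSum]

theorem adjugate_laplacian [NeZero r] {F : Matrix (Fin r) (Fin r) ℕ} (hF : IsCirculation F)
    (i j : Fin r) : (laplacian (rowSum F) F).adjugate i j = cof (laplacian (rowSum F) F) := by
  have h1 := sum_laplacian F
  have h2 : ∀ i, ∑ j, (laplacian (rowSum F) F).transpose i j = 0 := by
    intro i
    have := hF i
    simp [laplacian, Finset.sum_sub_distrib, Matrix.diagonal_apply, this]
    simp [rowSum]
  rw [adjugate_row_indep _ h1 i 0 j]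
  have h3 := adjugate_row_indep _ h2 j 0 0
  rw [← Matrix.adjugate_transpose] at h3
  simpa [cof] using h3

/-- With all row sums positive, the rooted Laplacian is the Laplacian with the row of `u` replaced
by a unit vector, so its determinant is a cofactor. The factor `rowSum F u` remains from `(rowSum F
u)!`. -/
theorem whittle_of_circulation [NeZero r] {F : Matrix (Fin r) (Fin r) ℕ} (hF : IsCirculation F)
    (hpos : ∀ i, 0 < rowSum F i) (u : Fin r) :
    whittle u F = rowSum F u * (cof (laplacian (rowSum F) F) * ∏ i, ((rowSum F i - 1)! : ℤ)) := by
  have hM : rootedLaplacian u F = (laplacian (rowSum F) F).updateRow u (Pi.single u 1) := by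
    ext i j
    by_cases hi : i = u
    · subst hi; simp [rootedLaplacian]
    · rw [Matrix.updateRow_ne hi]
      simp [rootedLaplacian, hi, (hpos i).ne', laplacian, Matrix.diagonal_apply, Pi.single_apply,
        eq_comm (a := i) (b := j)]
  rw [whittle, hM, ← Matrix.adjugate_apply, adjugate_laplacian hF,
    ← mul_prod_erase univ _ (mem_univ u)]
  obtain ⟨m, hm⟩ := Nat.exists_eq_succ_of_ne_zero (hpos u).ne'
  rw [hm, Nat.succ_eq_add_one, Nat.add_sub_cancel, Nat.factorial_succ]
  push_cast
  ring

/-- The contribution of the closed words with transition numbers `F`. -/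
def loopTerm [NeZero r] (G : Matrix (Fin r) (Fin r) ℂ⟦X⟧) (κ : Fin r → ℕ)
    (F : Matrix (Fin r) (Fin r) ℕ) : ℂ⟦X⟧ :=
  ((cof (laplacian (rowSum F) F) : ℂ) * ∏ a, ((-1 : ℂ) ^ (rowSum F a + κ a) *
    ((rowSum F a - 1)! : ℂ) * ((rowSum F a).choose (κ a) : ℂ))) • dividedMonomial G F

theorem loopTerm_eq_zero [NeZero r] {G : Matrix (Fin r) (Fin r) ℂ⟦X⟧} {κ : Fin r → ℕ}
    (hκ : ∀ a, 0 < κ a) {F : Matrix (Fin r) (Fin r) ℕ} {a : Fin r} (ha : rowSum F a = 0) :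
    loopTerm G κ F = 0 := by
  rw [loopTerm, prod_eq_zero (mem_univ a), mul_zero, zero_smul]
  rw [ha, Nat.choose_eq_zero_of_lt (hκ a)]
  simp

/-- The sum over the base letter `u` yields the total of all row sums, which is the length `m + 1`
of the word and cancels the weight $1/(m+1)$. If a row sum vanishes, both sides are zero since a
point with `0 < κ a` must be visited. -/
theorem loopTerm_eq_whittle [NeZero r] (G : Matrix (Fin r) (Fin r) ℂ⟦X⟧) {κ : Fin r → ℕ}
    (hκ : ∀ a, 0 < κ a) {F : Matrix (Fin r) (Fin r) ℕ} (hF : IsCirculation F) {m : ℕ}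
    (hm : ∑ i, rowSum F i = m + 1) :
    ((1 / ((m : ℂ) + 1)) * (∑ u, (whittle u F : ℂ)) *
      ∏ a, ((-1 : ℂ) ^ (rowSum F a + κ a) * ((rowSum F a).choose (κ a) : ℂ))) •
        dividedMonomial G F = loopTerm G κ F := by
  by_cases hpos : ∀ i, 0 < rowSum F i
  · rw [loopTerm]
    congr 1
    have h0 : ((m : ℂ) + 1) ≠ 0 := by exact_mod_cast Nat.succ_ne_zero m
    have h1 : ∑ u, (whittle u F : ℂ) = ((m : ℂ) + 1) *
        (cof (laplacian (rowSum F) F) * ∏ i, ((rowSum F i - 1)! : ℂ)) := by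
      have : ((m : ℂ) + 1) = ∑ i, (rowSum F i : ℂ) := by exact_mod_cast hm.symm
      rw [this, sum_mul]
      refine sum_congr rfl fun u _ => ?_
      rw [whittle_of_circulation hF hpos u]
      push_cast
      rfl
    rw [h1]
    simp only [prod_mul_distrib]
    field_simp
  · push Not at hpos
    obtain ⟨a, ha⟩ := hpos
    have ha' : rowSum F a = 0 := by omega
    rw [loopTerm_eq_zero hκ ha', prod_eq_zero (mem_univ a), mul_zero, zero_smul]
    rw [ha', Nat.choose_eq_zero_of_lt (hκ a)]
    simp

theorem modXPow_dividedMonomial {G : Matrix (Fin r) (Fin r) ℂ⟦X⟧}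
    (hG : ∀ a b, PowerSeries.constantCoeff (G a b) = 0) {M : ℕ} {F : Matrix (Fin r) (Fin r) ℕ}
    (hF : M ≤ ∑ i, rowSum F i) : modXPow M (dividedMonomial G F) = 0 := by
  rw [Ideal.Quotient.eq_zero_iff_mem, Ideal.mem_span_singleton]
  refine (pow_dvd_pow _ hF).trans ?_
  rw [← prod_pow_eq_pow_sum]
  refine prod_dvd_prod_of_dvd _ _ fun i _ => ?_
  rw [rowSum, ← prod_pow_eq_pow_sum]
  refine prod_dvd_prod_of_dvd _ _ fun j _ => ?_
  rw [Algebra.smul_def]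
  exact Dvd.dvd.mul_left (pow_dvd_pow_of_dvd (PowerSeries.X_dvd_iff.2 (hG i j)) _) _

/-- The matrices of natural numbers with entries at most `L`. -/
def boundedMatrices (r L : ℕ) : Finset (Matrix (Fin r) (Fin r) ℕ) :=
  (Fintype.piFinset fun _ => Fintype.piFinset fun _ => range (L + 1)).map
    (Matrix.of (m := Fin r) (n := Fin r) (α := ℕ)).toEmbedding

theorem mem_boundedMatrices {L : ℕ} {F : Matrix (Fin r) (Fin r) ℕ} :
    F ∈ boundedMatrices r L ↔ ∀ i j, F i j ≤ L := by
  simp only [boundedMatrices, mem_map_equiv, Fintype.mem_piFinset, mem_range, Nat.lt_succ_iff]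
  rfl

theorem entry_le_sum_rowSum (F : Matrix (Fin r) (Fin r) ℕ) (i j : Fin r) :
    F i j ≤ ∑ i, rowSum F i :=
  (single_le_sum (f := fun j => F i j) (fun _ _ => Nat.zero_le _) (mem_univ j)).trans
    (single_le_sum (f := fun i => rowSum F i) (fun _ _ => Nat.zero_le _) (mem_univ i))

-- A matrix with total at least `L + 1` contributes a multiple of $X^{L+1}$, and the zero matrix
-- contributes nothing, so both index sets give the same sum. The box of bounded entries is
-- preferred because it is a product of off-diagonal and diagonal parts.
open Classical in
theorem modXPow_sum_loopTerm [NeZero r] {G : Matrix (Fin r) (Fin r) ℂ⟦X⟧}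
    (hG : ∀ a b, PowerSeries.constantCoeff (G a b) = 0) {κ : Fin r → ℕ} (hκ : ∀ a, 0 < κ a)
    (L : ℕ) :
    modXPow (L + 1) (∑ m ∈ range (L + 1), ∑ F ∈ matricesOfSum (Fin r) (m + 1) with IsCirculation F,
      loopTerm G κ F) =
    modXPow (L + 1) (∑ F ∈ boundedMatrices r L with IsCirculation F, loopTerm G κ F) := by
  have hbig {F : Matrix (Fin r) (Fin r) ℕ} (hF : L + 1 ≤ ∑ i, rowSum F i) :
      modXPow (L + 1) (loopTerm G κ F) = 0 := by
    rw [loopTerm, PowerSeries.smul_eq_C_mul, map_mul, modXPow_dividedMonomial hG hF, mul_zero]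
  rw [← sum_biUnion]
  · rw [map_sum, map_sum]
    set S := (range (L + 1)).biUnion fun m => {F ∈ matricesOfSum (Fin r) (m + 1) | IsCirculation F}
    set S' := {F ∈ boundedMatrices r L | IsCirculation F}
    have hS (F : Matrix (Fin r) (Fin r) ℕ) : F ∈ S ↔
        (∃ m < L + 1, ∑ i, rowSum F i = m + 1) ∧ IsCirculation F := by
      simp only [S, mem_biUnion, mem_filter, mem_matricesOfSum, mem_range]
      constructor
      · rintro ⟨m, h1, h2, h3⟩; exact ⟨⟨m, h1, h2⟩, h3⟩
      · rintro ⟨⟨m, h1, h2⟩, h3⟩; exact ⟨m, h1, h2, h3⟩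
    have hS' (F : Matrix (Fin r) (Fin r) ℕ) : F ∈ S' ↔ (∀ i j, F i j ≤ L) ∧ IsCirculation F := by
      simp only [S', mem_filter, mem_boundedMatrices]
    rw [← sum_subset (inter_subset_left (s₁ := S) (s₂ := S')),
      ← sum_subset (inter_subset_right (s₁ := S) (s₂ := S'))]
    · intro F hF' hF
      rw [mem_inter, not_and'] at hF
      have h1 := hF hF'
      rw [hS, not_and'] at h1
      have h2 := h1 ((hS' F).1 hF').2
      push Not at h2
      by_cases h3 : L + 1 ≤ ∑ i, rowSum F i
      · exact hbig h3
      · have h0 : ∑ i, rowSum F i = 0 := by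
          by_contra h0
          exact h2 (∑ i, rowSum F i - 1) (by omega) (by omega)
        rw [loopTerm_eq_zero hκ (a := 0) (sum_eq_zero_iff.1 h0 0 (mem_univ _)), map_zero]
    · intro F hF' hF
      rw [mem_inter, not_and] at hF
      have h1 := hF hF'
      rw [hS', not_and'] at h1
      have h2 := h1 ((hS F).1 hF').2
      push Not at h2
      obtain ⟨i, j, hij⟩ := h2
      exact hbig (hij.trans_le (entry_le_sum_rowSum F i j))
  · intro m _ m' _ hmm'
    refine Finset.disjoint_left.2 fun F hF hF' => hmm' ?_
    have h1 := mem_matricesOfSum.1 (mem_filter.1 hF).1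
    have h2 := mem_matricesOfSum.1 (mem_filter.1 hF').1
    omega

theorem rowSum_add_diagonal (F : Matrix (Fin r) (Fin r) ℕ) (f : Fin r → ℕ) (i : Fin r) :
    rowSum (F + Matrix.diagonal f) i = rowSum F i + f i := by
  simp [rowSum, sum_add_distrib, Matrix.diagonal_apply]

theorem isCirculation_add_diagonal {F : Matrix (Fin r) (Fin r) ℕ} {f : Fin r → ℕ} :
    IsCirculation (F + Matrix.diagonal f) ↔ IsCirculation F := by
  refine forall_congr' fun i => ?_
  rw [Matrix.transpose_add, Matrix.diagonal_transpose, rowSum_add_diagonal, rowSum_add_diagonal]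
  omega

/-- Loops increase the row sums and the diagonal alike, so the cofactor depends on the off-diagonal
part only. -/
theorem laplacian_add_diagonal (F : Matrix (Fin r) (Fin r) ℕ) (f : Fin r → ℕ) :
    laplacian (rowSum (F + Matrix.diagonal f)) (F + Matrix.diagonal f) =
      laplacian (rowSum F) F := by
  ext i j
  by_cases h : i = j
  · subst h; simp [laplacian, rowSum_add_diagonal]
  · simp [laplacian, h]

theorem dividedMonomial_add_diagonal {A : Type*} [CommRing A] [Algebra ℚ A]
    (G : Matrix (Fin r) (Fin r) A) {F : Matrix (Fin r) (Fin r) ℕ} (hF : ∀ i, F i i = 0)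
    (f : Fin r → ℕ) : dividedMonomial G (F + Matrix.diagonal f) =
      dividedMonomial G F * ∏ a, (1 / ((f a)! : ℚ)) • G a a ^ f a := by
  unfold dividedMonomial
  rw [← prod_mul_distrib]
  refine prod_congr rfl fun i _ => ?_
  rw [← mul_prod_erase univ _ (mem_univ i), ← mul_prod_erase univ _ (mem_univ i)]
  simp only [Matrix.add_apply, Matrix.diagonal_apply_eq, hF, zero_add]
  rw [Nat.factorial_zero, pow_zero]
  rw [prod_congr rfl fun j hj => by
    rw [Matrix.diagonal_apply_ne _ (ne_of_mem_erase hj).symm, add_zero]]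
  simp
  ring_nf

open Classical in
/-- Summation over the diagonals of the matrices of transition numbers. -/
theorem sum_loopTerm_eq [NeZero r] (G : Matrix (Fin r) (Fin r) ℂ⟦X⟧) (κ : Fin r → ℕ) (L : ℕ) :
    ∑ F ∈ boundedMatrices r L with IsCirculation F, loopTerm G κ F =
    ∑ F ∈ boundedMatrices r L with (∀ i, F i i = 0) ∧ IsCirculation F,
      (cof (laplacian (rowSum F) F) : ℂ) • (dividedMonomial G F * ∏ a, ∑ f ∈ range (L + 1),
        ((-1 : ℂ) ^ (rowSum F a + f + κ a) * ((rowSum F a + f - 1)! : ℂ) *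
          ((rowSum F a + f).choose (κ a) : ℂ) / (f ! : ℂ)) • G a a ^ f) := by
  have h1 : ∀ F ∈ {F ∈ boundedMatrices r L | (∀ i, F i i = 0) ∧ IsCirculation F},
      (cof (laplacian (rowSum F) F) : ℂ) • (dividedMonomial G F * ∏ a, ∑ f ∈ range (L + 1),
        ((-1 : ℂ) ^ (rowSum F a + f + κ a) * ((rowSum F a + f - 1)! : ℂ) *
          ((rowSum F a + f).choose (κ a) : ℂ) / (f ! : ℂ)) • G a a ^ f) =
      ∑ f ∈ Fintype.piFinset fun _ : Fin r => range (L + 1),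
        loopTerm G κ (F + Matrix.diagonal f) := by
    intro F hF
    have hF0 := (mem_filter.1 hF).2.1
    rw [prod_univ_sum, mul_sum, smul_sum]
    refine sum_congr rfl fun f _ => ?_
    rw [loopTerm, laplacian_add_diagonal, dividedMonomial_add_diagonal G hF0, mul_smul]
    congr 1
    rw [← mul_smul_comm]
    congr 1
    simp only [PowerSeries.smul_eq_C_mul, map_prod]
    rw [← prod_mul_distrib]
    refine prod_congr rfl fun a _ => ?_
    rw [rowSum_add_diagonal]
    have : (1 / ((f a)! : ℚ)) • G a a ^ f a = PowerSeries.C (1 / ((f a)! : ℂ)) * G a a ^ f a := by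
      rw [← PowerSeries.smul_eq_C_mul, ← Rat.cast_smul_eq_qsmul ℂ]
      push_cast; rfl
    rw [this, ← mul_assoc, ← map_mul]
    congr 2
    ring
  rw [sum_congr rfl h1, ← sum_product']
  symm
  -- A bounded circulation is uniquely an off-diagonal circulation plus an arbitrary bounded
  -- diagonal.
  refine sum_bij' (fun x _ => x.1 + Matrix.diagonal x.2)
    (fun F _ => (F - Matrix.diagonal F.diag, F.diag)) ?_ ?_ ?_ ?_ (fun _ _ => rfl)
  · rintro ⟨F, f⟩ hx
    simp only [mem_product, mem_filter, mem_boundedMatrices, Fintype.mem_piFinset, mem_range] at hx ⊢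
    obtain ⟨⟨h1, h2, h3⟩, h4⟩ := hx
    refine ⟨fun i j => ?_, isCirculation_add_diagonal.2 h3⟩
    by_cases hij : i = j
    · subst hij
      have := h4 i
      simp only [Matrix.add_apply, Matrix.diagonal_apply_eq, h2]; omega
    · simpa [hij] using h1 i j
  · intro F hF
    simp only [mem_product, mem_filter, mem_boundedMatrices, Fintype.mem_piFinset, mem_range] at hF ⊢
    have hadd : F - Matrix.diagonal F.diag + Matrix.diagonal F.diag = F := by
      ext i j
      by_cases hij : i = j
      · subst hij; simp
      · simp [hij]
    refine ⟨⟨fun i j => (Nat.sub_le _ _).trans (hF.1 i j), fun i => by simp, ?_⟩,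
      fun a => Nat.lt_succ_of_le (hF.1 a a)⟩
    rw [← hadd, isCirculation_add_diagonal] at hF
    exact hF.2
  · rintro ⟨F, f⟩ hx
    simp only [mem_product, mem_filter] at hx
    have hd : (F + Matrix.diagonal f).diag = f := by
      funext i; simp [hx.1.2.1 i]
    rw [hd]
    refine Prod.ext ?_ rfl
    ext i j; simp
  · intro F _
    ext i j
    by_cases hij : i = j
    · subst hij; simp
    · simp [hij]

end Circulations

/-! ### Closed walks through given points -/

theorem stepSeries_eq_greenSeries {d : ℕ} (p : Lattice d) : stepSeries ℂ p = greenSeries p := by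
  ext n
  rw [coeff_greenSeries, stepSeries, PowerSeries.coeff_mk]

theorem greenSeries_neg {d : ℕ} (p : Lattice d) : greenSeries (-p) = greenSeries p := by
  ext n
  rw [coeff_greenSeries, coeff_greenSeries, stepCount, stepCount, walkCount_neg]

theorem constantCoeff_greenSeries {d : ℕ} (p : Lattice d) :
    PowerSeries.constantCoeff (greenSeries p) = 0 := by
  rw [← stepSeries_eq_greenSeries, constantCoeff_stepSeries]

section

variable {d r : ℕ}

/-- The matrix of the Taylor series of the Green's functions between the points `Y`. -/
def greenMatrix (Y : Fin r → Lattice d) : Matrix (Fin r) (Fin r) ℂ⟦X⟧ :=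
  Matrix.of fun a b => greenSeries (Y a - Y b)

/-- The mark `t a` depends only on the point that is left, so its exponent is a row sum; the
remaining factor has constant coefficients in the marks. -/
theorem dividedMonomial_transitionMatrix (Y : Fin r → Lattice d)
    (t : Fin r → MvPolynomial (Fin r) ℂ) (F : Matrix (Fin r) (Fin r) ℕ) :
    dividedMonomial (transitionMatrix Y t) F = PowerSeries.C (∏ a, t a ^ rowSum F a) *
      PowerSeries.map MvPolynomial.C (dividedMonomial (greenMatrix Y) F) := by
  unfold dividedMonomial
  simp only [map_prod, ← prod_mul_distrib]
  refine prod_congr rfl fun a _ => ?_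
  rw [rowSum, ← prod_pow_eq_pow_sum, map_prod, ← prod_mul_distrib]
  refine prod_congr rfl fun b _ => ?_
  have h : stepSeries (MvPolynomial (Fin r) ℂ) (Y b - Y a) =
      PowerSeries.map MvPolynomial.C (greenMatrix Y a b) := by
    rw [greenMatrix, Matrix.of_apply, ← neg_sub (Y b), greenSeries_neg]
    ext1 n
    rw [PowerSeries.coeff_map, coeff_greenSeries, stepSeries, PowerSeries.coeff_mk, map_natCast]
  rw [map_rat_smul, mul_smul_comm, transitionMatrix, Matrix.of_apply, h, mul_pow, map_pow, map_pow]

/-- The summand of the main theorem, for a tuple `κ` of multiplicities. -/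
def tupleSummand [NeZero r] (κ : Fin r → ℕ) (Y : Fin r → Lattice d) (h : Fin r → ℕ)
    (F : Matrix (Fin r) (Fin r) ℕ) : ℂ⟦X⟧ :=
  (cof (laplacian h F) : ℂ) •
    ((∏ a, ∏ b, (1 / ((F a b)! : ℂ)) •
        (greenSeries (Y a - Y b) ^ F a b * ((1 + greenSeries (0 : Lattice d))⁻¹) ^ F a b)) *
      ∏ j, ((-1 : ℂ) ^ h j * ((h j)! : ℂ)) • vertexK (h j) (κ j) (greenSeries (0 : Lattice d)))

/-- The denominators $(1+h(0))^{F_{ab}}$ of a row are collected at its vertex, which is the form in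
which `vertex_identity` delivers them. -/
theorem tupleSummand_eq [NeZero r] (κ : Fin r → ℕ) (Y : Fin r → Lattice d)
    (F : Matrix (Fin r) (Fin r) ℕ) :
    tupleSummand κ Y (rowSum F) F = (cof (laplacian (rowSum F) F) : ℂ) •
      (dividedMonomial (greenMatrix Y) F * ∏ a, ((-1 : ℂ) ^ rowSum F a * ((rowSum F a)! : ℂ)) •
        (((1 + greenSeries (0 : Lattice d))⁻¹) ^ rowSum F a *
          vertexK (rowSum F a) (κ a) (greenSeries (0 : Lattice d)))) := by
  rw [tupleSummand, dividedMonomial, ← prod_mul_distrib, ← prod_mul_distrib]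
  congr 1
  refine prod_congr rfl fun a _ => ?_
  have h : ∏ b, (1 / ((F a b)! : ℂ)) •
      (greenSeries (Y a - Y b) ^ F a b * ((1 + greenSeries (0 : Lattice d))⁻¹) ^ F a b) =
      (∏ b, (1 / ((F a b)! : ℚ)) • greenMatrix Y a b ^ F a b) *
        ((1 + greenSeries (0 : Lattice d))⁻¹) ^ rowSum F a := by
    rw [rowSum, ← prod_pow_eq_pow_sum, ← prod_mul_distrib]
    refine prod_congr rfl fun b _ => ?_
    rw [← smul_mul_assoc, ← Rat.cast_smul_eq_qsmul ℂ]
    push_cast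
    rfl
  rw [h, mul_assoc, mul_smul_comm]

open Classical in
/-- The matrices over which the main sum extends, up to order `L`. -/
def edgeMatrices (r L : ℕ) : Finset (Matrix (Fin r) (Fin r) ℕ) :=
  {F ∈ boundedMatrices r L | (∀ i, F i i = 0) ∧ IsCirculation F}

theorem modXPow_sum_tupleSummand [NeZero r] {κ : Fin r → ℕ} (hκ : ∀ a, 0 < κ a)
    (Y : Fin r → Lattice d) (L : ℕ) :
    modXPow (L + 1) (∑ F ∈ edgeMatrices r L, (cof (laplacian (rowSum F) F) : ℂ) •
      (dividedMonomial (greenMatrix Y) F * ∏ a, ∑ f ∈ range (L + 1),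
        ((-1 : ℂ) ^ (rowSum F a + f + κ a) * ((rowSum F a + f - 1)! : ℂ) *
          ((rowSum F a + f).choose (κ a) : ℂ) / (f ! : ℂ)) • greenMatrix Y a a ^ f)) =
    modXPow (L + 1) (∑ F ∈ edgeMatrices r L, tupleSummand κ Y (rowSum F) F) := by
  rw [map_sum, map_sum]
  refine sum_congr rfl fun F _ => ?_
  rw [tupleSummand_eq, PowerSeries.smul_eq_C_mul, PowerSeries.smul_eq_C_mul]
  simp only [map_mul (modXPow (L + 1)), map_prod]
  congr 2
  refine prod_congr rfl fun a _ => ?_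
  rw [greenMatrix, Matrix.of_apply, sub_self,
    vertex_identity (constantCoeff_greenSeries 0) L (rowSum F a) (hκ a)]

open Classical in
/-- The number of closed walks of length `n` visiting the points `Y` with the multiplicities `κ`. -/
theorem sum_coeff_weightSum [NeZero r] {κ : Fin r → ℕ} (hκ : ∀ a, 0 < κ a)
    (Y : Fin r → Lattice d) {n L : ℕ} (hn : n ≤ L) :
    ∑ p ∈ reachable Y (L + 1), MvPolynomial.coeff (Finsupp.equivFunOnFinite.symm κ)
      (weightSum (perturbedWeight Y fun a => (MvPolynomial.X a - 1 : MvPolynomial (Fin r) ℂ))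
        n p p) =
      n * PowerSeries.coeff n (∑ F ∈ edgeMatrices r L, tupleSummand κ Y (rowSum F) F) := by
  set κ' : Fin r →₀ ℕ := Finsupp.equivFunOnFinite.symm κ with hκ'
  have hκ0 : κ' ≠ 0 := fun h => (hκ 0).ne' (by simpa [hκ'] using DFunLike.congr_fun h 0)
  set t : Fin r → MvPolynomial (Fin r) ℂ := fun a => MvPolynomial.X a - 1
  have h1 := congrArg (MvPolynomial.coeff κ') (sum_weightSum_sub Y t (Nat.lt_succ_of_le hn))
  -- The number of free walks is a constant polynomial and does not affect the nonconstant monomial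
  -- `κ'`.
  have hc (m : ℕ) : MvPolynomial.coeff κ' (m : MvPolynomial (Fin r) ℂ) = 0 := by
    rw [← map_natCast MvPolynomial.C, MvPolynomial.coeff_C, if_neg hκ0.symm]
  simp only [MvPolynomial.coeff_sum, MvPolynomial.coeff_sub, hc, sub_zero] at h1
  rw [h1, ← map_natCast MvPolynomial.C n, MvPolynomial.coeff_C_mul, ← coeff_extract]
  congr 1
  refine modXPow_eq_iff.1 ?_ n (Nat.lt_succ_of_le hn)
  rw [← modXPow_sum_tupleSummand hκ, edgeMatrices, ← sum_loopTerm_eq, ← modXPow_sum_loopTerm _ hκ]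
  · congr 1
    rw [map_sum]
    refine sum_congr rfl fun m _ => ?_
    rw [map_rat_smul, Matrix.trace, map_sum]
    simp only [Matrix.diag, matrix_pow_apply, isFlow_self_iff]
    simp only [map_sum, map_rat_smul, dividedMonomial_transitionMatrix, extract_C_mul_map]
    rw [sum_comm, smul_sum]
    refine sum_congr rfl fun F hF => ?_
    rw [mem_filter, mem_matricesOfSum] at hF
    rw [← loopTerm_eq_whittle (greenMatrix Y) hκ hF.2 hF.1, ← sum_smul, coeff_prod_X_sub_one_pow,
      ← Rat.cast_smul_eq_qsmul ℂ, ← Rat.cast_smul_eq_qsmul ℂ, smul_smul, smul_smul]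
    congr 1
    push_cast
    simp [hκ', mul_assoc]
  · exact fun a b => constantCoeff_greenSeries _

end

/-! ### The symbol `P` as a number of tuples of points -/

theorem sum_single_apply {ι : Type*} (s : Finset ι) (v : ι → ℕ) (m : ℕ) :
    (∑ x ∈ s, Finsupp.single (v x) 1 : ℕ →₀ ℕ) m = #{x ∈ s | v x = m} := by
  rw [Finsupp.finsetSum_apply, card_filter]
  exact sum_congr rfl fun x _ => Finsupp.single_apply

/-- Both maps have fibres of equal size, and bijections between the fibres combine to a permutation.
-/
theorem exists_perm_of_sum_single_eq {r : ℕ} {f k : Fin r → ℕ}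
    (h : (∑ j, Finsupp.single (f j) 1 : ℕ →₀ ℕ) = ∑ j, Finsupp.single (k j) 1) :
    ∃ τ : Equiv.Perm (Fin r), ∀ j, f j = k (τ j) := by
  have e (m : ℕ) : {a // f a = m} ≃ {b // k b = m} := by
    refine Fintype.equivOfCardEq ?_
    rw [Fintype.card_subtype, Fintype.card_subtype, ← sum_single_apply, ← sum_single_apply, h]
  exact ⟨Equiv.ofFiberEquiv e, fun j => (Equiv.ofFiberEquiv_map e j).symm⟩

theorem PermClass.tuple_injective {r : ℕ} {k : Fin r → ℕ} :
    Function.Injective (PermClass.tuple (k := k)) := by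
  intro σ τ h
  induction σ using Quotient.inductionOn
  induction τ using Quotient.inductionOn
  exact Quotient.sound fun i => congrFun h i

theorem PermClass.tuple_pos {r : ℕ} {k : Fin r → ℕ} (hk : ∀ i, 0 < k i) (σ : PermClass k)
    (i : Fin r) : 0 < σ.tuple i := by
  induction σ using Quotient.inductionOn
  exact hk _

theorem card_permClass_tuple_eq {r : ℕ} (k f : Fin r → ℕ) :
    #{σ : PermClass k | f = σ.tuple} =
      if (∑ j, Finsupp.single (f j) 1 : ℕ →₀ ℕ) = ∑ j, Finsupp.single (k j) 1 then 1 else 0 := by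
  split_ifs with h
  · obtain ⟨τ, hτ⟩ := exists_perm_of_sum_single_eq h
    rw [card_eq_one]
    refine ⟨Quotient.mk _ τ, ?_⟩
    ext σ
    rw [mem_filter, mem_singleton]
    have hf : f = PermClass.tuple (Quotient.mk _ τ : PermClass k) := funext hτ
    constructor
    · rintro ⟨-, h⟩
      exact PermClass.tuple_injective (h.symm.trans hf)
    · rintro rfl
      exact ⟨mem_univ _, hf⟩
  · rw [card_eq_zero, filter_eq_empty_iff]
    intro σ _ hσ
    refine h ?_
    subst hσ
    induction σ using Quotient.inductionOn with | h τ =>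
    exact Fintype.sum_equiv τ _ _ fun j => rfl

theorem card_injective_image_eq {α : Type*} [DecidableEq α] {r : ℕ} {S t : Finset α}
    (hS : t ⊆ S) (ht : #t = r) :
    #{q ∈ Fintype.piFinset fun _ : Fin r => S | Function.Injective q ∧ univ.image q = t} = r ! := by
  classical
  let e : Fin r ≃ t := (finCongr ht.symm).trans t.equivFin.symm
  have h : {q ∈ Fintype.piFinset fun _ : Fin r => S | Function.Injective q ∧ univ.image q = t} =
      (univ : Finset (Equiv.Perm (Fin r))).image fun τ j => (e (τ j) : α) := by
    ext q
    simp only [mem_filter, Fintype.mem_piFinset, mem_image, mem_univ, true_and]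
    constructor
    · rintro ⟨-, hinj, him⟩
      have hmem (j : Fin r) : q j ∈ t := him ▸ mem_image_of_mem q (mem_univ j)
      let g : Fin r → Fin r := fun j => e.symm ⟨q j, hmem j⟩
      have hg : Function.Injective g := fun a b hab => hinj (by
        simpa [g] using hab)
      refine ⟨Equiv.ofBijective g (Finite.injective_iff_bijective.1 hg), funext fun j => ?_⟩
      simp [g]
    · rintro ⟨τ, rfl⟩
      refine ⟨fun j => hS (e (τ j)).2, fun a b hab => ?_, ?_⟩
      · exact τ.injective (e.injective (Subtype.ext hab))
      · ext x
        simp only [mem_image, mem_univ, true_and]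
        constructor
        · rintro ⟨j, rfl⟩; exact (e (τ j)).2
        · intro hx; exact ⟨τ.symm (e.symm ⟨x, hx⟩), by simp⟩
  rw [h, card_image_of_injective, card_univ, Fintype.card_perm, Fintype.card_fin]
  intro σ τ hστ
  ext j
  have := congrFun hστ j
  simpa [Fin.ext_iff] using this

/-- The coefficient counts the subsets of `S` whose values under `v` form the multiset of `k`. Each
such subset has `r !` orderings, and the values of an ordering belong to exactly one class of
permutations. -/
theorem factorial_mul_symbolP {α : Type*} [DecidableEq α] {r : ℕ} (S : Finset α) (v : α → ℕ)
    (N : ℕ → ℕ) (k : Fin r → ℕ) (hN : ∀ j, N (k j) = #{x ∈ S | v x = k j}) :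
    r ! * symbolP N k = ∑ σ : PermClass k, #{q ∈ Fintype.piFinset fun _ : Fin r => S |
      Function.Injective q ∧ ∀ a, v (q a) = σ.tuple a} := by
  classical
  set m : ℕ →₀ ℕ := ∑ j, Finsupp.single (k j) 1 with hm
  have h1 : symbolP N k = #{t ∈ S.powerset | (∑ x ∈ t, Finsupp.single (v x) 1 : ℕ →₀ ℕ) = m} := by
    have h2 : ∏ i ∈ univ.image k, (1 + MvPolynomial.X i : MvPolynomial ℕ ℕ) ^ N i =
        ∏ x ∈ S with v x ∈ univ.image k, (1 + MvPolynomial.X (v x)) := by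
      rw [← prod_fiberwise_of_maps_to (g := v) (t := univ.image k)
        (fun x hx => (mem_filter.1 hx).2)]
      refine prod_congr rfl fun i hi => ?_
      obtain ⟨j, -, rfl⟩ := mem_image.1 hi
      rw [hN, filter_filter, prod_congr rfl (fun x hx => by rw [(mem_filter.1 hx).2.2]), prod_const]
      congr 2
      ext x
      simp only [mem_filter, and_congr_right_iff]
      exact fun _ => ⟨fun h => ⟨h ▸ hi, h⟩, fun h => h.2⟩
    have h3 (t : Finset α) : ∏ x ∈ t, (MvPolynomial.X (v x) : MvPolynomial ℕ ℕ) =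
        MvPolynomial.monomial (∑ x ∈ t, Finsupp.single (v x) 1) 1 := by
      rw [MvPolynomial.monomial_sum_one]
      rfl
    rw [symbolP, h2, prod_one_add, MvPolynomial.coeff_sum, card_filter]
    simp only [h3, MvPolynomial.coeff_monomial, ← hm]
    -- A subset with the right monomial only contains points whose value occurs among the `k j`.
    refine sum_subset (powerset_mono.2 (filter_subset _ _)) fun t ht ht' => if_neg fun h => ht' ?_
    rw [mem_powerset] at ht ⊢
    refine fun x hx => mem_filter.2 ⟨ht hx, ?_⟩
    have h4 : m (v x) ≠ 0 := by
      rw [← h, sum_single_apply]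
      exact card_ne_zero_of_mem (mem_filter.2 ⟨hx, rfl⟩)
    rw [hm, sum_single_apply] at h4
    obtain ⟨j, hj⟩ := card_pos.1 (Nat.pos_of_ne_zero h4)
    exact mem_image.2 ⟨j, mem_univ j, (mem_filter.1 hj).2⟩
  set Q := {q ∈ Fintype.piFinset fun _ : Fin r => S | Function.Injective q}
  have h5 : ∑ σ : PermClass k, #{q ∈ Fintype.piFinset fun _ : Fin r => S |
      Function.Injective q ∧ ∀ a, v (q a) = σ.tuple a} =
      #{q ∈ Q | (∑ j, Finsupp.single (v (q j)) 1 : ℕ →₀ ℕ) = m} := by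
    have h6 (σ : PermClass k) : #{q ∈ Fintype.piFinset fun _ : Fin r => S |
        Function.Injective q ∧ ∀ a, v (q a) = σ.tuple a} =
        ∑ q ∈ Q, if (fun j => v (q j)) = σ.tuple then 1 else 0 := by
      rw [← card_filter, filter_filter]
      simp only [funext_iff]
    simp only [h6]
    rw [sum_comm, card_filter]
    refine sum_congr rfl fun q _ => ?_
    rw [← card_filter, card_permClass_tuple_eq]
  rw [h5, h1, card_eq_sum_card_fiberwise (f := fun q => univ.image q)
    (t := {t ∈ S.powerset | (∑ x ∈ t, Finsupp.single (v x) 1 : ℕ →₀ ℕ) = m})]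
  · rw [mul_comm, ← smul_eq_mul, ← sum_const]
    refine sum_congr rfl fun t ht => ?_
    rw [mem_filter, mem_powerset] at ht
    -- Comparison of total degrees.
    have hcard : #t = r := by
      have := congrArg Finsupp.degree ht.2
      simpa [hm, map_sum] using this
    rw [← card_injective_image_eq ht.1 hcard, filter_filter, filter_filter]
    congr 1
    refine filter_congr fun q _ => ?_
    constructor
    · rintro ⟨h, him⟩
      refine ⟨h, ?_, him⟩
      rw [← ht.2, ← him, sum_image fun a _ b _ hab => h hab]
    · rintro ⟨h, -, him⟩
      exact ⟨h, him⟩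
  · intro q hq
    simp only [Q, coe_filter, mem_filter, Fintype.mem_piFinset, Set.mem_ofPred_eq, mem_powerset] at hq ⊢
    refine ⟨fun x hx => ?_, ?_⟩
    · obtain ⟨j, -, rfl⟩ := mem_image.1 hx
      exact hq.1.1 j
    · rw [sum_image fun a _ b _ hab => hq.1.2 hab, hq.2]

/-! ### Weighted sums over walks -/

section Lists

variable {d : ℕ}

/-- Prepending a step. -/
def consEmbedding (d : ℕ) : Step d × List (Step d) ↪ List (Step d) :=
  ⟨fun x => x.1 :: x.2, fun x y h => by
    simp only [List.cons.injEq] at h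
    exact Prod.ext h.1 h.2⟩

/-- The sequences of `n` steps. -/
def stepLists (d : ℕ) : ℕ → Finset (List (Step d))
  | 0 => {[]}
  | n + 1 => ((univ : Finset (Step d)) ×ˢ stepLists d n).map (consEmbedding d)

theorem sum_stepLists_succ {M : Type*} [AddCommMonoid M] (n : ℕ) (f : List (Step d) → M) :
    ∑ l ∈ stepLists d (n + 1), f l = ∑ s : Step d, ∑ l ∈ stepLists d n, f (s :: l) := by
  rw [stepLists, sum_map, sum_product]
  rfl

theorem mem_stepLists {n : ℕ} {l : List (Step d)} : l ∈ stepLists d n ↔ l.length = n := by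
  induction n generalizing l with
  | zero => simp [stepLists]
  | succ n ih =>
    rw [stepLists, mem_map]
    constructor
    · rintro ⟨⟨s, l'⟩, h, rfl⟩
      exact congrArg (· + 1) (ih.1 (mem_product.1 h).2)
    · intro h
      obtain ⟨s, l', rfl⟩ := List.exists_cons_of_length_eq_add_one h
      exact ⟨(s, l'), mem_product.2 ⟨mem_univ _, ih.2 (by simpa using h)⟩, rfl⟩

theorem Walk.point_zero (p : Lattice d) (l : List (Step d)) : Walk.point ⟨p, l⟩ 0 = p := by
  simp [Walk.point]

theorem Walk.point_cons (p : Lattice d) (s : Step d) (l : List (Step d)) (i : ℕ) :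
    Walk.point ⟨p, s :: l⟩ (i + 1) = Walk.point ⟨p + s.vec, l⟩ i := by
  simp [Walk.point, add_assoc]

theorem Walk.point_translate (p q : Lattice d) (l : List (Step d)) (i : ℕ) :
    Walk.point ⟨p + q, l⟩ i = p + Walk.point ⟨q, l⟩ i := by
  simp [Walk.point, add_assoc]

theorem weightSum_eq_sum {R : Type*} [CommRing R] (lam : Lattice d → R) (n : ℕ) (p q : Lattice d) :
    weightSum lam n p q = ∑ l ∈ stepLists d n with Walk.point ⟨p, l⟩ n = q,
      ∏ i ∈ range n, lam (Walk.point ⟨p, l⟩ i) := by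
  induction n generalizing p with
  | zero =>
    rw [stepLists, filter_singleton, Walk.point_zero, weightSum]
    split_ifs <;> simp
  | succ n ih =>
    rw [weightSum, sum_filter, sum_stepLists_succ, mul_sum]
    refine sum_congr rfl fun s _ => ?_
    rw [ih, sum_filter, mul_sum]
    refine sum_congr rfl fun l _ => ?_
    simp only [Walk.point_cons, prod_range_succ', Walk.point_zero]
    split_ifs
    · rw [mul_comm]
    · simp

/-- The number of steps of `w` that leave `q`. -/
def Walk.visits (w : Walk d) (q : Lattice d) : ℕ := #{i ∈ range w.length | w.point i = q}

/-- Arrivals and departures differ by a shift of the index, which is harmless as the end points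
coincide. -/
theorem Walk.mu_of_isClosed {w : Walk d} (hw : w.IsClosed) (q : Lattice d) :
    w.mu q = 2 * w.visits q := by
  have h : #{i ∈ range w.length | w.point (i + 1) = q} = w.visits q := by
    have h0 : w.point 0 = w.start := by simp [Walk.point]
    rw [Walk.visits, card_filter, card_filter]
    have h1 := sum_range_succ (fun i => if w.point i = q then 1 else 0) w.length
    rw [sum_range_succ', hw, h0] at h1
    exact Nat.add_right_cancel h1
  rw [Walk.mu, h, Walk.visits, two_mul]

theorem Walk.visits_translate (p q x : Lattice d) (l : List (Step d)) :
    Walk.visits ⟨p + q, l⟩ (p + x) = Walk.visits ⟨q, l⟩ x := by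
  unfold Walk.visits
  simp only [Walk.point_translate, add_right_inj]
  rfl

variable {r : ℕ}

/-- The number of closed walks of length `n` from `0` that visit each `q a` exactly `κ a` times. -/
def closedCount (n : ℕ) (κ : Fin r → ℕ) (q : Fin r → Lattice d) : ℕ :=
  #{l ∈ stepLists d n | Walk.point ⟨0, l⟩ n = 0 ∧ ∀ a, Walk.visits ⟨0, l⟩ (q a) = κ a}

/-- For `t a = X a - 1` the weight at `Y a` is `X a`, so the weight of a walk is the monomial of its
visit numbers. Translation by `-p` moves the start to the origin. -/
theorem coeff_weightSum {Y : Fin r → Lattice d} (hY : Function.Injective Y) (κ : Fin r → ℕ) (n : ℕ)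
    (p : Lattice d) :
    MvPolynomial.coeff (Finsupp.equivFunOnFinite.symm κ)
      (weightSum (perturbedWeight Y fun a => (MvPolynomial.X a - 1 : MvPolynomial (Fin r) ℂ))
        n p p) = closedCount n κ (fun a => Y a - p) := by
  have hw (x : Lattice d) : perturbedWeight Y (fun a => (MvPolynomial.X a - 1 : MvPolynomial (Fin r) ℂ)) x
      = ∏ a, MvPolynomial.X a ^ (if x = Y a then 1 else 0) := by
    rw [perturbedWeight]
    by_cases h : ∃ a, x = Y a
    · obtain ⟨a, rfl⟩ := h
      rw [sum_eq_single a, prod_eq_single a]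
      · simp
      · intro b _ hb; simp [hY.ne hb.symm]
      · simp
      · intro b _ hb; simp [hY.ne hb.symm]
      · simp
    · push Not at h
      simp [h]
  have hl : ∀ l ∈ stepLists d n, ∏ i ∈ range n, perturbedWeight Y
      (fun a => (MvPolynomial.X a - 1 : MvPolynomial (Fin r) ℂ)) (Walk.point ⟨p, l⟩ i) =
      MvPolynomial.monomial
        (Finsupp.equivFunOnFinite.symm fun a => Walk.visits ⟨p, l⟩ (Y a)) 1 := by
    intro l hl
    simp only [hw]
    rw [prod_comm, MvPolynomial.monomial_eq, Finsupp.prod_fintype _ _ (by simp), map_one, one_mul]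
    refine prod_congr rfl fun a _ => ?_
    rw [prod_pow_eq_pow_sum, ← card_filter]
    simp [Walk.visits, Walk.length, mem_stepLists.1 hl]
  rw [weightSum_eq_sum, sum_congr rfl fun l h => hl l (mem_filter.1 h).1, MvPolynomial.coeff_sum,
    closedCount]
  simp only [MvPolynomial.coeff_monomial]
  rw [← Finset.natCast_card_filter, filter_filter]
  congr 2
  refine filter_congr fun l _ => ?_
  have h1 : Walk.point ⟨p, l⟩ n = p ↔ Walk.point ⟨0, l⟩ n = 0 := by
    have := Walk.point_translate p 0 l n
    rw [add_zero] at this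
    rw [this]; simp
  have h2 (a : Fin r) : Walk.visits ⟨0, l⟩ (Y a - p) = Walk.visits ⟨p, l⟩ (Y a) := by
    have := Walk.visits_translate p 0 (Y a - p) l
    rw [add_zero, add_sub_cancel] at this
    exact this.symm
  simp only [h1, h2, Equiv.apply_eq_iff_eq, funext_iff]

end Lists

/-! ### Finiteness of the main sum -/

section Finiteness

variable {d r : ℕ}

theorem mem_edgeMatrices {L : ℕ} {F : Matrix (Fin r) (Fin r) ℕ} : F ∈ edgeMatrices r L ↔
    (∀ i j, F i j ≤ L) ∧ (∀ i, F i i = 0) ∧ IsCirculation F := by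
  classical
  rw [edgeMatrices, mem_filter, mem_boundedMatrices]

theorem mem_balanced_iff {h : Fin r → ℕ} {F : Matrix (Fin r) (Fin r) ℕ} :
    F ∈ balanced h ↔ ((∀ i, F i i = 0) ∧ IsCirculation F) ∧ rowSum F = h := by
  constructor
  · rintro ⟨h0, h1⟩
    exact ⟨⟨h0, fun i => (h1 i).2.trans (h1 i).1.symm⟩, funext fun i => (h1 i).2⟩
  · rintro ⟨⟨h0, h1⟩, rfl⟩
    exact ⟨h0, fun i => ⟨(h1 i).symm, rfl⟩⟩

variable [NeZero r]

theorem modXPow_tupleSummand_eq_zero {κ : Fin r → ℕ} {Y : Fin r → Lattice d}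
    {F : Matrix (Fin r) (Fin r) ℕ} {M : ℕ} (h : modXPow M (dividedMonomial (greenMatrix Y) F) = 0) :
    modXPow M (tupleSummand κ Y (rowSum F) F) = 0 := by
  rw [tupleSummand_eq, PowerSeries.smul_eq_C_mul, map_mul, map_mul, h, zero_mul, mul_zero]

theorem diamond_eq_zero_iff {M : ℕ} {g : ℂ⟦X⟧} : diamond M g = 0 ↔ modXPow (M + 1) g = 0 := by
  rw [← map_zero (modXPow (M + 1)), modXPow_eq_iff, Polynomial.ext_iff]
  simp only [diamond, PowerSeries.coeff_trunc, Polynomial.coeff_zero, map_zero, ite_eq_right_iff]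

theorem mem_edgeMatrices_of_diamond_ne_zero {κ : Fin r → ℕ} {Y : Fin r → Lattice d}
    {h : Fin r → ℕ} {F : Matrix (Fin r) (Fin r) ℕ} {L : ℕ} (hF : F ∈ balanced h)
    (hT : diamond L (tupleSummand κ Y h F) ≠ 0) : F ∈ edgeMatrices r L := by
  obtain ⟨h1, rfl⟩ := mem_balanced_iff.1 hF
  refine mem_edgeMatrices.2 ⟨fun i j => ?_, h1⟩
  by_contra hij
  push Not at hij
  refine hT (diamond_eq_zero_iff.2 (modXPow_tupleSummand_eq_zero ?_))
  exact modXPow_dividedMonomial (fun a b => constantCoeff_greenSeries _)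
    (Nat.succ_le_of_lt (hij.trans_le (entry_le_sum_rowSum F i j)))

/-- Otherwise the indicator of the indices not connected to `0` is a kernel vector of the Laplacian
with its first row replaced by a unit vector. -/
theorem connected_of_cof_ne_zero {F : Matrix (Fin r) (Fin r) ℕ}
    (hcof : cof (laplacian (rowSum F) F) ≠ 0) (b : Fin r) :
    Relation.ReflTransGen (fun a b => F a b ≠ 0 ∨ F b a ≠ 0) 0 b := by
  classical
  by_contra hb
  set R := Relation.ReflTransGen (fun a b => F a b ≠ 0 ∨ F b a ≠ 0) (0 : Fin r)
  have hzero {a c : Fin r} (ha : R a) (hc : ¬ R c) : F a c = 0 ∧ F c a = 0 := by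
    constructor
    · by_contra h; exact hc (ha.tail (Or.inl h))
    · by_contra h; exact hc (ha.tail (Or.inr h))
  apply hcof
  rw [cof, Matrix.adjugate_apply, ← Matrix.exists_mulVec_eq_zero_iff]
  refine ⟨fun a => if R a then 0 else 1, fun h => by simpa [hb] using congrFun h b, ?_⟩
  funext a
  by_cases ha0 : a = 0
  · subst ha0
    have : R 0 := Relation.ReflTransGen.refl
    simp [Matrix.mulVec, this]
  · rw [Matrix.mulVec, dotProduct, Matrix.updateRow_ne ha0]
    by_cases ha : R a
    · refine sum_eq_zero fun c _ => ?_
      by_cases hc : R c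
      · simp [hc]
      · have hac : a ≠ c := fun h => hc (h ▸ ha)
        simp [laplacian, hac, (hzero ha hc).1]
    · have h1 : ∀ c, laplacian (rowSum F) F a c * (if R c then 0 else 1) =
          laplacian (rowSum F) F a c := by
        intro c
        by_cases hc : R c
        · have hac : a ≠ c := fun h => ha (h ▸ hc)
          simp [laplacian, hac, (hzero hc ha).2]
        · simp [hc]
      exact (sum_congr rfl fun c _ => h1 c).trans (sum_laplacian F a)

/-- An edge `F a b ≠ 0` restricts `Y a - Y b` to the finitely many points reached in at most `L`
steps. Since `F` is connected and `Y 0 = 0`, each `Y b` has finitely many values. -/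
theorem finite_pointTuples (κ : Fin r → ℕ) (L : ℕ) (F : Matrix (Fin r) (Fin r) ℕ) :
    {Y : Fin r → Lattice d | Y ∈ pointTuples d r ∧
      diamond L (tupleSummand κ Y (rowSum F) F) ≠ 0}.Finite := by
  set D : Set (Lattice d) := ⋃ n : Fin (L + 1), {p | walkCount (n : ℕ) p ≠ 0}
  have hD : D.Finite := Set.finite_iUnion fun n => finite_walkCount_ne_zero (n : ℕ)
  set S := {Y : Fin r → Lattice d | Y ∈ pointTuples d r ∧
      diamond L (tupleSummand κ Y (rowSum F) F) ≠ 0} with hS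
  have hdiff {Y : Fin r → Lattice d} (hY : Y ∈ S) {a b : Fin r} (hab : F a b ≠ 0) :
      Y a - Y b ∈ D := by
    by_contra h
    refine hY.2 (diamond_eq_zero_iff.2 (modXPow_tupleSummand_eq_zero ?_))
    have hz : modXPow (L + 1) (greenMatrix Y a b) = 0 := by
      rw [← map_zero (modXPow (L + 1)), modXPow_eq_iff]
      intro n hn
      rw [greenMatrix, Matrix.of_apply, coeff_greenSeries, map_zero, stepCount]
      by_contra h2
      refine h (Set.mem_iUnion.2 ⟨⟨n, hn⟩, fun h3 => h2 ?_⟩)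
      simp only at h3
      simp [h3]
    rw [dividedMonomial, map_prod]
    refine prod_eq_zero (mem_univ a) ?_
    rw [map_prod]
    refine prod_eq_zero (mem_univ b) ?_
    rw [Algebra.smul_def, map_mul, map_pow, hz, zero_pow hab, mul_zero]
  by_cases hcof : cof (laplacian (rowSum F) F) = 0
  · refine Set.Finite.subset Set.finite_empty fun Y hY => hY.2 ?_
    rw [tupleSummand, hcof]
    simp [diamond]
  · have hfin (b : Fin r) : ((fun Y : Fin r → Lattice d => Y b) '' S).Finite := by
      induction connected_of_cof_ne_zero hcof b with
      | refl =>
        refine (Set.finite_singleton (0 : Lattice d)).subset ?_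
        rintro _ ⟨Y, hY, rfl⟩
        exact hY.1.1
      | @tail b c _ hbc ih =>
        refine ((ih.sub hD).union (ih.add hD)).subset ?_
        rintro _ ⟨Y, hY, rfl⟩
        rcases hbc with h | h
        · refine Or.inl ?_
          rw [Set.mem_sub]
          exact ⟨Y b, ⟨Y, hY, rfl⟩, Y b - Y c, hdiff hY h, sub_sub_cancel _ _⟩
        · refine Or.inr ?_
          rw [Set.mem_add]
          exact ⟨Y b, ⟨Y, hY, rfl⟩, Y c - Y b, hdiff hY h, add_sub_cancel _ _⟩
    refine (Set.Finite.pi fun b => hfin b).subset fun Y hY => ?_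
    exact fun b _ => ⟨Y, hY, rfl⟩

theorem finite_summands (κ : Fin r → ℕ) (L : ℕ) :
    {T : (Fin r → Lattice d) × (Fin r → ℕ) × Matrix (Fin r) (Fin r) ℕ |
      T.1 ∈ pointTuples d r ∧ T.2.2 ∈ balanced T.2.1 ∧
      diamond L (tupleSummand κ T.1 T.2.1 T.2.2) ≠ 0}.Finite := by
  refine (Set.Finite.biUnion (edgeMatrices r L).finite_toSet fun F _ =>
    (finite_pointTuples (d := d) κ L F).image
      fun Y => (Y, rowSum F, F)).subset ?_
  rintro ⟨Y, h, F⟩ ⟨h1, h2, h3⟩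
  simp only at h1 h2 h3
  have hF := mem_edgeMatrices_of_diamond_ne_zero h2 h3
  obtain ⟨-, rfl⟩ := mem_balanced_iff.1 h2
  exact Set.mem_biUnion hF ⟨Y, ⟨h1, h3⟩, rfl⟩

/-- The point tuples that contribute up to order `L`. -/
def contributing (d : ℕ) (κ : Fin r → ℕ) (L : ℕ) : Finset (Fin r → Lattice d) :=
  (((finite_summands (d := d) κ L).image Prod.fst).toFinset)

theorem contributing_subset (κ : Fin r → ℕ) (L : ℕ) :
    (contributing d κ L : Set (Fin r → Lattice d)) ⊆ pointTuples d r := by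
  intro Y hY
  simp only [contributing, Set.Finite.coe_toFinset] at hY
  obtain ⟨T, hT, rfl⟩ := hY
  exact hT.1

theorem diamond_eq_zero_of_notMem_contributing {κ : Fin r → ℕ} {L : ℕ} {Y : Fin r → Lattice d}
    (hY : Y ∈ pointTuples d r) (hY' : Y ∉ contributing d κ L) {F : Matrix (Fin r) (Fin r) ℕ}
    (hF : F ∈ edgeMatrices r L) : diamond L (tupleSummand κ Y (rowSum F) F) = 0 := by
  by_contra h
  refine hY' ?_
  rw [contributing, Set.Finite.mem_toFinset]
  exact ⟨(Y, rowSum F, F), ⟨hY, mem_balanced_iff.2 ⟨(mem_edgeMatrices.1 hF).2, rfl⟩, h⟩, rfl⟩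

theorem finsum_summands (κ : Fin r → ℕ) (L : ℕ) :
    ∑ᶠ (Y : Fin r → Lattice d) (_ : Y ∈ pointTuples d r), ∑ᶠ h : Fin r → ℕ,
      ∑ᶠ (F : Matrix (Fin r) (Fin r) ℕ) (_ : F ∈ balanced h), diamond L (tupleSummand κ Y h F) =
    ∑ Y ∈ contributing d κ L, ∑ F ∈ edgeMatrices r L,
      diamond L (tupleSummand κ Y (rowSum F) F) := by
  classical
  have h1 (Y : Fin r → Lattice d) (h : Fin r → ℕ) :
      ∑ᶠ (F : Matrix (Fin r) (Fin r) ℕ) (_ : F ∈ balanced h), diamond L (tupleSummand κ Y h F) =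
      ∑ F ∈ edgeMatrices r L with rowSum F = h, diamond L (tupleSummand κ Y (rowSum F) F) := by
    rw [finsum_mem_eq_sum_of_subset (t := {F ∈ edgeMatrices r L | rowSum F = h})]
    · exact sum_congr rfl fun F hF => by rw [(mem_filter.1 hF).2]
    · rintro F ⟨hF, hF'⟩
      exact mem_coe.2 (mem_filter.2
        ⟨mem_edgeMatrices_of_diamond_ne_zero hF hF', (mem_balanced_iff.1 hF).2⟩)
    · intro F hF
      have := mem_filter.1 (mem_coe.1 hF)
      exact mem_balanced_iff.2 ⟨(mem_edgeMatrices.1 this.1).2, this.2⟩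
  have h2 (Y : Fin r → Lattice d) : ∑ᶠ h : Fin r → ℕ, ∑ F ∈ edgeMatrices r L with rowSum F = h,
      diamond L (tupleSummand κ Y (rowSum F) F) =
      ∑ F ∈ edgeMatrices r L, diamond L (tupleSummand κ Y (rowSum F) F) := by
    rw [finsum_eq_sum_of_support_subset (s := (edgeMatrices r L).image rowSum)]
    · exact sum_fiberwise_of_maps_to (fun F hF => mem_image_of_mem _ hF) _
    · intro h hh
      obtain ⟨F, hF, -⟩ := exists_ne_zero_of_sum_ne_zero hh
      rw [mem_filter] at hF
      exact mem_coe.2 (mem_image.2 ⟨F, hF⟩)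
  simp only [h1, h2]
  refine finsum_mem_eq_sum_of_subset _ ?_ (contributing_subset κ L)
  rintro Y ⟨hY, hY'⟩
  by_contra h
  exact hY' (sum_eq_zero fun F hF => diamond_eq_zero_of_notMem_contributing hY h hF)

end Finiteness

/-! ### The main identity -/

section Main

variable {d r : ℕ}

/-- The points that are left by a walk from `0`. -/
def visited (n : ℕ) (l : List (Step d)) : Finset (Lattice d) := (range n).image (Walk.point ⟨0, l⟩)

theorem mem_visited {n : ℕ} {l : List (Step d)} (hl : l ∈ stepLists d n) {x : Lattice d}
    (hx : 0 < Walk.visits ⟨0, l⟩ x) : x ∈ visited n l := by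
  obtain ⟨i, hi⟩ := card_pos.1 hx
  rw [mem_filter] at hi
  rw [visited, mem_image]
  refine ⟨i, ?_, hi.2⟩
  rw [← mem_stepLists.1 hl]
  exact hi.1

theorem isClosed_iff {n : ℕ} {l : List (Step d)} (hl : l ∈ stepLists d n) :
    Walk.IsClosed ⟨0, l⟩ ↔ Walk.point ⟨0, l⟩ n = 0 := by
  rw [Walk.IsClosed, Walk.length, mem_stepLists.1 hl]

theorem factorial_mul_symbolP_multRange {k : Fin r → ℕ} (hk : ∀ i, 0 < k i) {n : ℕ}
    {l : List (Step d)} (hl : l ∈ stepLists d n) (hc : Walk.point ⟨0, l⟩ n = 0) :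
    r ! * symbolP (fun m => Walk.multRange m ⟨0, l⟩) k =
      ∑ σ : PermClass k, #{q ∈ Fintype.piFinset fun _ : Fin r => visited n l |
        Function.Injective q ∧ ∀ a, Walk.visits ⟨0, l⟩ (q a) = σ.tuple a} := by
  refine factorial_mul_symbolP (visited n l) (Walk.visits ⟨0, l⟩) _ k fun j => ?_
  rw [Walk.multRange, ← Set.ncard_coe_finset]
  congr 1
  ext x
  have h := Walk.mu_of_isClosed ((isClosed_iff hl).2 hc) x
  simp only [Set.mem_ofPred_eq, h, coe_filter]
  constructor
  · intro h2
    have h3 : Walk.visits ⟨0, l⟩ x = k j := by omega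
    exact ⟨mem_visited hl (by rw [h3]; exact hk j), h3⟩
  · rintro ⟨-, h2⟩
    rw [h2]

-- An ordered tuple `q` visited by a closed walk from `0` corresponds to `Y = q - q 0` together with
-- the translated starting point `p = -q 0`.
open Classical in
theorem sum_card_tuples [NeZero r] {κ : Fin r → ℕ} (hκ : ∀ a, 0 < κ a) {n L : ℕ} (hn : n ≤ L) :
    (∑ l ∈ stepLists d n with Walk.point ⟨0, l⟩ n = 0,
      (#{q ∈ Fintype.piFinset fun _ : Fin r => visited n l |
        Function.Injective q ∧ ∀ a, Walk.visits ⟨0, l⟩ (q a) = κ a} : ℂ)) =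
    ∑ Y ∈ contributing d κ L,
      n * PowerSeries.coeff n (∑ F ∈ edgeMatrices r L, tupleSummand κ Y (rowSum F) F) := by
  set Q : Finset (Fin r → Lattice d) :=
    {q ∈ Fintype.piFinset fun _ : Fin r => (stepLists d n).biUnion (visited n) |
      Function.Injective q} with hQ
  have hQmem {q : Fin r → Lattice d} (hq : Function.Injective q) (h0 : closedCount n κ q ≠ 0) :
      q ∈ Q := by
    obtain ⟨l, hl⟩ := card_pos.1 (Nat.pos_of_ne_zero h0)
    rw [mem_filter] at hl
    refine mem_filter.2 ⟨Fintype.mem_piFinset.2 fun a => mem_biUnion.2 ⟨l, hl.1, ?_⟩, hq⟩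
    exact mem_visited hl.1 (by rw [hl.2.2 a]; exact hκ a)
  have h1 : ∑ l ∈ stepLists d n with Walk.point ⟨0, l⟩ n = 0,
      #{q ∈ Fintype.piFinset fun _ : Fin r => visited n l |
        Function.Injective q ∧ ∀ a, Walk.visits ⟨0, l⟩ (q a) = κ a} =
      ∑ q ∈ Q, closedCount n κ q := by
    have h2 : ∀ l ∈ {l ∈ stepLists d n | Walk.point ⟨0, l⟩ n = 0},
        #{q ∈ Fintype.piFinset fun _ : Fin r => visited n l |
          Function.Injective q ∧ ∀ a, Walk.visits ⟨0, l⟩ (q a) = κ a} =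
        ∑ q ∈ Q, if ∀ a, Walk.visits ⟨0, l⟩ (q a) = κ a then 1 else 0 := by
      intro l hl
      have hl' := (mem_filter.1 hl).1
      rw [← card_filter, hQ, filter_filter]
      congr 1
      ext q
      simp only [mem_filter, Fintype.mem_piFinset]
      constructor
      · rintro ⟨h, h'⟩
        exact ⟨fun a => mem_biUnion.2 ⟨l, hl', h a⟩, h'⟩
      · rintro ⟨-, h'⟩
        exact ⟨fun a => mem_visited hl' (by rw [h'.2 a]; exact hκ a), h'⟩
    rw [sum_congr rfl h2, sum_comm]
    refine sum_congr rfl fun q _ => ?_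
    rw [← card_filter, filter_filter, closedCount]
  have hcount {Y : Fin r → Lattice d} (hY : Y ∈ pointTuples d r) :
      ((∑ p ∈ reachable Y (L + 1), closedCount n κ (fun a => Y a - p) : ℕ) : ℂ) =
      n * PowerSeries.coeff n (∑ F ∈ edgeMatrices r L, tupleSummand κ Y (rowSum F) F) := by
    have hinj : Function.Injective Y := fun a b hab => by
      by_contra h
      exact hY.2 a b h hab
    rw [← sum_coeff_weightSum hκ Y hn, Nat.cast_sum]
    exact sum_congr rfl fun p _ => (coeff_weightSum hinj κ n p).symm
  -- At an unreachable starting point the weighted sum is constant in the marks, so its coefficient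
  -- at the nonconstant monomial would be zero.
  have hreach {q : Fin r → Lattice d} (hq : Function.Injective q) (h0 : closedCount n κ q ≠ 0) :
      -q 0 ∈ reachable (fun a => q a - q 0) (L + 1) := by
    by_contra h
    have hinj : Function.Injective fun a => q a - q 0 := fun a b hab => hq (sub_left_injective hab)
    have h2 := coeff_weightSum hinj κ n (-q 0)
    rw [weightSum_of_notMem_reachable _ _ (Nat.lt_succ_of_le hn) h, ← map_natCast MvPolynomial.C,
      MvPolynomial.coeff_C, if_neg] at h2
    · simp only [sub_neg_eq_add, sub_add_cancel] at h2
      exact h0 (by exact_mod_cast h2.symm)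
    · intro h3
      exact (hκ 0).ne (by simpa using DFunLike.congr_fun h3 0)
  have htuple {q : Fin r → Lattice d} (hq : Function.Injective q) :
      (fun a => q a - q 0) ∈ pointTuples d r :=
    ⟨sub_self _, fun a b hab h => hab (hq (sub_left_injective h))⟩
  -- If the translated tuple did not contribute, the whole count over starting points would vanish;
  -- it is a sum of natural numbers with a nonzero term at `-q 0`.
  have hmaps : ∀ q ∈ {q ∈ Q | closedCount n κ q ≠ 0},
      (fun a => q a - q 0) ∈ contributing d κ L := by
    intro q hq
    rw [mem_filter] at hq
    have hinj := (mem_filter.1 hq.1).2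
    by_contra h
    have h2 := hcount (htuple hinj)
    rw [map_sum, sum_eq_zero (s := edgeMatrices r L), mul_zero] at h2
    · have h3 := sum_eq_zero_iff.1 (Nat.cast_eq_zero.1 h2) (-q 0) (hreach hinj hq.2)
      simp only [sub_neg_eq_add, sub_add_cancel] at h3
      exact hq.2 h3
    · intro F hF
      have h4 := diamond_eq_zero_iff.1 (diamond_eq_zero_of_notMem_contributing (htuple hinj) h hF)
      rw [← map_zero (modXPow (L + 1)), modXPow_eq_iff] at h4
      simpa using h4 n (Nat.lt_succ_of_le hn)
  rw [← Nat.cast_sum, h1, ← sum_filter_ne_zero, ← sum_fiberwise_of_maps_to hmaps, Nat.cast_sum]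
  refine sum_congr rfl fun Y hY => ?_
  have hYt := contributing_subset κ L (mem_coe.2 hY)
  rw [← hcount hYt]
  congr 1
  symm
  have hYinj : Function.Injective Y := fun a b hab => by
    by_contra h
    exact hYt.2 a b h hab
  refine sum_bij_ne_zero (fun p _ _ a => Y a - p) ?_ ?_ ?_ (fun _ _ _ => rfl)
  · intro p _ h0
    rw [mem_filter, mem_filter]
    refine ⟨⟨hQmem (fun a b hab => hYinj (sub_left_injective hab)) h0, h0⟩, ?_⟩
    funext a
    simp [hYt.1]
  · intro p _ _ p' _ _ h
    exact sub_right_injective (congrFun h 0)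
  · intro q hq h0
    rw [mem_filter, mem_filter] at hq
    obtain ⟨⟨hqQ, -⟩, rfl⟩ := hq
    have hq' : (fun a => q a - q 0 - -q 0) = q := by funext a; simp
    exact ⟨-q 0, hreach (mem_filter.1 hqQ).2 h0, by rw [hq']; exact h0, hq'⟩

theorem coeff_sum_closedWalks (d M n : ℕ) (f : Walk d → ℕ) :
    Polynomial.coeff (∑ᶠ w ∈ closedWalks d M, (f w : Polynomial ℂ) * Polynomial.X ^ w.length) n =
      if n ≤ M then ∑ l ∈ stepLists d n with Walk.point ⟨0, l⟩ n = 0, (f ⟨0, l⟩ : ℂ) else 0 := by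
  rw [finsum_mem_eq_finite_toFinset_sum _ (closedWalks_finite d M), Polynomial.finsetSum_coeff]
  have h1 (w : Walk d) : Polynomial.coeff ((f w : Polynomial ℂ) * Polynomial.X ^ w.length) n =
      if w.length = n then (f w : ℂ) else 0 := by
    rw [← Polynomial.C_eq_natCast, Polynomial.coeff_C_mul, Polynomial.coeff_X_pow]
    simp [eq_comm]
  simp only [h1]
  rw [← sum_filter]
  split_ifs with hn
  · symm
    refine sum_bij (fun l _ => ⟨0, l⟩) ?_ ?_ ?_ (fun _ _ => rfl)
    · intro l hl
      rw [mem_filter] at hl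
      rw [mem_filter, Set.Finite.mem_toFinset]
      have hlen : Walk.length ⟨(0 : Lattice d), l⟩ = n := mem_stepLists.1 hl.1
      exact ⟨⟨rfl, (isClosed_iff hl.1).2 hl.2, hlen.le.trans hn⟩, hlen⟩
    · intro l _ l' _ h
      exact congrArg Walk.steps h
    · rintro ⟨s, l⟩ hw
      rw [mem_filter, Set.Finite.mem_toFinset] at hw
      obtain ⟨⟨hs, hc, -⟩, hlen⟩ := hw
      simp only at hs
      subst hs
      have hl : l ∈ stepLists d n := mem_stepLists.2 hlen
      exact ⟨l, mem_filter.2 ⟨hl, (isClosed_iff hl).1 hc⟩, rfl⟩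
  · refine sum_eq_zero fun w hw => absurd ?_ hn
    rw [mem_filter, Set.Finite.mem_toFinset] at hw
    exact hw.2 ▸ hw.1.2.2

end Main

end RangeMoments

end

/-! ### The theorem -/

theorem mainTheorem1 (d N r : ℕ) [NeZero r] (k : Fin r → ℕ) (hk : ∀ i, 0 < k i) :
    (∀ (p : RangeMoments.Lattice d) (z : ℂ), 2 * (d : ℝ) * ‖z‖ < 1 →
      MeasureTheory.IntegrableOn (RangeMoments.greenIntegrand p z) (Set.Ioi (0 : ℝ)) ∧
      HasSum (fun n : ℕ => PowerSeries.coeff n (RangeMoments.greenSeries p) * z ^ n)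
        (RangeMoments.green p z)) ∧
    (∀ σ : RangeMoments.PermClass k,
      {T : (Fin r → RangeMoments.Lattice d) × (Fin r → ℕ) × Matrix (Fin r) (Fin r) ℕ |
        T.1 ∈ RangeMoments.pointTuples d r ∧ T.2.2 ∈ RangeMoments.balanced T.2.1 ∧
        RangeMoments.diamond (2 * N) (RangeMoments.summand σ T.1 T.2.1 T.2.2) ≠ 0}.Finite) ∧
    ∑ᶠ w ∈ RangeMoments.closedWalks d (2 * N),
        (RangeMoments.symbolP (fun m => w.multRange m) k : Polynomial ℂ) *
          Polynomial.X ^ w.length =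
      Polynomial.C (1 / (r.factorial : ℂ)) * (Polynomial.X * Polynomial.derivative
        (∑ σ : RangeMoments.PermClass k,
          ∑ᶠ (Y : Fin r → RangeMoments.Lattice d) (_ : Y ∈ RangeMoments.pointTuples d r),
            ∑ᶠ h : Fin r → ℕ,
              ∑ᶠ (F : Matrix (Fin r) (Fin r) ℕ) (_ : F ∈ RangeMoments.balanced h),
                RangeMoments.diamond (2 * N) (RangeMoments.summand σ Y h F))) := by
  classical
  refine ⟨fun p z hz => ⟨RangeMoments.integrableOn_greenIntegrand p hz,
    RangeMoments.green_expansion p hz⟩,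
    fun σ => RangeMoments.finite_summands σ.tuple (2 * N), ?_⟩
  have hsum (σ : RangeMoments.PermClass k) :
      ∑ᶠ (Y : Fin r → RangeMoments.Lattice d) (_ : Y ∈ RangeMoments.pointTuples d r),
        ∑ᶠ h : Fin r → ℕ, ∑ᶠ (F : Matrix (Fin r) (Fin r) ℕ) (_ : F ∈ RangeMoments.balanced h),
          RangeMoments.diamond (2 * N) (RangeMoments.summand σ Y h F) =
      ∑ Y ∈ RangeMoments.contributing d σ.tuple (2 * N), ∑ F ∈ RangeMoments.edgeMatrices r (2 * N),
        RangeMoments.diamond (2 * N)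
          (RangeMoments.tupleSummand σ.tuple Y (RangeMoments.rowSum F) F) :=
    RangeMoments.finsum_summands σ.tuple (2 * N)
  simp only [hsum]
  ext n
  have hX (Q : Polynomial ℂ) : Polynomial.coeff (Polynomial.X * Polynomial.derivative Q) n =
      n * Q.coeff n := by
    rcases n with _ | n
    · simp
    · rw [Polynomial.coeff_X_mul, Polynomial.coeff_derivative]
      push_cast; ring
  rw [RangeMoments.coeff_sum_closedWalks d (2 * N) n
    (fun w => RangeMoments.symbolP (fun m => w.multRange m) k), Polynomial.coeff_C_mul, hX]
  simp only [Polynomial.finsetSum_coeff, RangeMoments.diamond, PowerSeries.coeff_trunc,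
    Nat.lt_succ_iff]
  split_ifs with hn
  · have hr : (r ! : ℂ) ≠ 0 := by exact_mod_cast Nat.factorial_ne_zero r
    -- After multiplication by `r !` the left side counts ordered tuples, and the identity can be
    -- checked for each class `σ`.
    rw [one_div, eq_inv_mul_iff_mul_eq₀ hr, mul_sum, mul_sum]
    have h1 : ∀ l ∈ {l ∈ RangeMoments.stepLists d n | RangeMoments.Walk.point ⟨0, l⟩ n = 0},
        (r ! : ℂ) * (RangeMoments.symbolP (fun m => RangeMoments.Walk.multRange m ⟨0, l⟩) k : ℂ) =
        ∑ σ : RangeMoments.PermClass k,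
          (#{q ∈ Fintype.piFinset fun _ : Fin r => RangeMoments.visited n l |
            Function.Injective q ∧
              ∀ a, RangeMoments.Walk.visits ⟨0, l⟩ (q a) = σ.tuple a} : ℂ) := by
      intro l hl
      rw [mem_filter] at hl
      exact_mod_cast RangeMoments.factorial_mul_symbolP_multRange hk hl.1 hl.2
    rw [sum_congr rfl h1, sum_comm]
    refine sum_congr rfl fun σ _ => ?_
    rw [RangeMoments.sum_card_tuples (RangeMoments.PermClass.tuple_pos hk σ) hn, mul_sum]
    simp only [map_sum]
  · simp
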